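/- Consider a finite simple graph $G=(V,E)$ with edge values $x=(x_e)_{e\in E}\in[0,1]^E$ such that $(G,x)$ is $1$-regular, i.e. $\sum_{e\ni v}x_e=1$ for every $v\in V$. Each edge $e$ is active with probability $x_e$, and each vertex $v$ has a seed $t_v$ uniform on $[0,1]$; all edge states and seeds are independent. The edges are processed in increasing lexicographic order of $(\min\{t_u,t_v\},\max\{t_u,t_v\})$, $e=(u,v)$ (ties, which have probability $0$, are broken arbitrarily), and the greedy contention resolution scheme selects an arriving edge exactly when it is active and shares no vertex with a previously selected edge. The scheme is called $c$-selectable on $(G,x)$ if every edge $e\in E$ is selected with probability at least $c\,x_e$. Under this random order the greedy scheme is $\left(1-\ln\left(2-\frac1e\right)\right)\approx 0.510$-selectable on $1$-regular inputs with vanishing edge values. That is, with $c^*=1-\ln(2-1/e)$: (i) There is a function $f:\mathbb R\to\mathbb R$ with $\lim_{\varepsilon\to0^+}f(\varepsilon)=0$ such that for every $1$-regular input $(G,x)$ the scheme is $\left(c^*-f(\max_{e\in E}x_e)\right)$-selectable on $(G,x)$. (ii) For every sequence of $1$-regular inputs $(G(n),x(n))$ for which there are $\varepsilon(n)\to0$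 with $x_e(n)\le\varepsilon(n)$ for every edge $e$ of $G(n)$, there are reals $c_n\to c^*$ such that for every $n$ the scheme is $c_n$-selectable on $(G(n),x(n))$. -/

import Mathlib

open MeasureTheory ProbabilityTheory Filter Topology unitInterval

noncomputable section

namespace GreedyCRS

variable {V : Type*} [Fintype V] [DecidableEq V] (G : SimpleGraph V) [DecidableRel G.Adj]

/-- The input `(G, x)` is `1`-regular: the edge values at every vertex sum to `1`. -/
def IsOneRegular (x : G.edgeSet → I) : Prop :=
  ∀ v : V, ∑ e ∈ Finset.univ.filter (fun e : G.edgeSet => v ∈ (e : Sym2 V)), (x e : ℝ) = 1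

/-- The sort key `(min, max)` of an edge: the smaller and the larger seed of its endpoints,
compared lexicographically. -/
def edgeKey (t : V → I) (e : G.edgeSet) : I ×ₗ I :=
  toLex (((e : Sym2 V).map t).inf, ((e : Sym2 V).map t).sup)

/-- All edges of `G`, each listed once, in lexicographic order of `(min seed, max seed)`.
Ties need two equal seeds and so have probability `0`; they are broken arbitrarily. -/
def lexOrder (t : V → I) : List G.edgeSet :=
  (Finset.univ : Finset G.edgeSet).toList.mergeSort
    (fun e f => decide (edgeKey G t e ≤ edgeKey G t f))

variable {G}

/-- The arriving edge `e` is feasible for the current matching `M`: it shares no vertex with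
an edge of `M`. -/
def Feasible (M : Finset G.edgeSet) (e : G.edgeSet) : Prop :=
  ∀ f ∈ M, ∀ v : V, ¬ (v ∈ (e : Sym2 V) ∧ v ∈ (f : Sym2 V))

open scoped Classical in
/-- One step of the greedy scheme: accept the arriving edge if and only if it is active and
feasible. -/
def greedyStep (active : G.edgeSet → Bool) (M : Finset G.edgeSet) (e : G.edgeSet) :
    Finset G.edgeSet :=
  if active e = true ∧ Feasible M e then insert e M else M

/-- The set of edges selected by the greedy scheme when the edges arrive in the order of the
list `l` (head first). -/
def greedyMatching (active : G.edgeSet → Bool) (l : List G.edgeSet) : Finset G.edgeSet :=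
  l.foldl (greedyStep active) ∅

/-- The joint law of the seeds and the edge states: all seeds are uniform on `[0, 1]`, edge `e`
is active with probability `x e`, and all these variables are independent. -/
def law (x : G.edgeSet → I) : Measure ((V → I) × (G.edgeSet → Bool)) :=
  (Measure.pi fun _ : V => (volume : Measure I)).prod
    (Measure.pi fun e : G.edgeSet => bernoulliMeasure true false (x e))

/-- The greedy scheme under the lexicographic random order selects every edge `e` of the input
`(G, x)` with probability at least `c * x e`. -/
def LexGreedySelectable (c : ℝ) (x : G.edgeSet → I) : Prop :=
  ∀ e : G.edgeSet,
    c * (x e : ℝ) ≤ (law x).real {ω | e ∈ greedyMatching ω.2 (lexOrder G ω.1)}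

end GreedyCRS

end

set_option linter.unusedSectionVars false

noncomputable section

namespace GreedyCRS

/-! ### The greedy matching as the solution of a recursion -/

section Greedy

variable {V : Type*} [Fintype V] [DecidableEq V] {G : SimpleGraph V} [DecidableRel G.Adj]

/-! At a vertex `u` the edges arrive in the order of the seeds of their other endpoints
(`pairKey_lt_iff`). So `u`, with seed `a`, is still free when threshold `b` is reached exactly when
no active neighbour `w` with seed below `b` is itself free, in the graph without `u`, up to
threshold `a` (`isFree_insert_iff`). An active edge is selected when each endpoint is free in the
graph without the other (`selected_mk_iff`). Written as a product over neighbours, this recursion is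
`freeInd`.

The offers made to `u` do not depend on the states of the edges at `u`, so these states can be
averaged out. Freeness becomes a product of factors `1 - x_{uw} * offer_w`, which for small edge
values is close to `exp (-offerMass)`. If the offer mass is almost deterministic, 1-regularity
forces the limiting free probability `f` to satisfy `f a b = exp (-∫ c in 0..b, f c a)`, and `exp a
/ (exp a + exp b - 1)` is a solution. The probability that both endpoints of an edge are free then
tends to `∫∫ f a b * f b a = 1 - log (2 - 1 / e)`.

The core is the concentration bound `integral_offerMass_sub_sq_le`, a second moment estimate by
induction on the vertex set that needs no girth assumption. Diagonal terms contribute at most `ε`.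
For distinct `w`, `w'`, deleting each vertex from the graph in which the other's offer is computed
costs `O(ε)` (`integral_abs_freeInd_erase_le`). After that the two offers are independent given the
remaining graph, and the product of their conditional deviations is controlled by the inductive
bound there, integrated over a seed. The weight `exp (2 * (a + b))` makes every such integration
contract by a factor `1/2`, so errors do not accumulate with the depth of the recursion. -/

lemma mem_foldl_greedyStep_of_notMem (active : G.edgeSet → Bool) (l : List G.edgeSet)
    (M : Finset G.edgeSet) {e : G.edgeSet} (he : e ∉ l) :
    e ∈ l.foldl (greedyStep active) M ↔ e ∈ M := by
  induction l generalizing M with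
  | nil => simp
  | cons a l ih =>
    simp only [List.mem_cons, not_or] at he
    rw [List.foldl_cons, ih _ he.2]
    unfold greedyStep
    split_ifs <;> simp [he.1]

/-- Decisions are final, so the matching present when `e` arrives is the final matching restricted
to earlier edges. This replaces the fold by a self-referential characterisation. -/
lemma mem_greedyMatching_append (active : G.edgeSet → Bool) {l₁ l₂ : List G.edgeSet}
    {e : G.edgeSet} (h : (l₁ ++ e :: l₂).Nodup) :
    e ∈ greedyMatching active (l₁ ++ e :: l₂) ↔
      active e = true ∧ ∀ f ∈ l₁, f ∈ greedyMatching active (l₁ ++ e :: l₂) →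
        ∀ v : V, ¬ (v ∈ (e : Sym2 V) ∧ v ∈ (f : Sym2 V)) := by
  have hd : e ∉ l₁ ∧ e ∉ l₂ ∧ ∀ f ∈ l₁, f ≠ e ∧ f ∉ l₂ := by
    rw [List.nodup_append] at h
    refine ⟨fun he => h.2.2 e he e (by simp) rfl, (List.nodup_cons.1 h.2.1).1, fun f hf => ?_⟩
    exact ⟨h.2.2 f hf e (by simp), fun hf2 => h.2.2 f hf f (by simp [hf2]) rfl⟩
  have key : ∀ f ∈ l₁, (f ∈ greedyMatching active (l₁ ++ e :: l₂) ↔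
      f ∈ greedyMatching active l₁) := by
    intro f hf
    unfold greedyMatching
    rw [List.foldl_append, List.foldl_cons, mem_foldl_greedyStep_of_notMem _ _ _ (hd.2.2 f hf).2]
    unfold greedyStep
    split_ifs <;> simp [(hd.2.2 f hf).1]
  have hsub : ∀ f, f ∈ greedyMatching active l₁ → f ∈ l₁ := by
    intro f hf
    by_contra hf2
    unfold greedyMatching at hf
    rw [mem_foldl_greedyStep_of_notMem _ _ _ hf2] at hf
    simp at hf
  have hne : e ∉ greedyMatching active l₁ := fun h => hd.1 (hsub e h)
  have hfeas : Feasible (greedyMatching active l₁) e ↔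
      ∀ f ∈ l₁, f ∈ greedyMatching active (l₁ ++ e :: l₂) →
        ∀ v : V, ¬ (v ∈ (e : Sym2 V) ∧ v ∈ (f : Sym2 V)) :=
    ⟨fun h f hf hfm => h f ((key f hf).1 hfm),
      fun h f hf => h f (hsub f hf) ((key f (hsub f hf)).2 hf)⟩
  rw [← hfeas]
  conv_lhs => unfold greedyMatching
  rw [List.foldl_append, List.foldl_cons, mem_foldl_greedyStep_of_notMem _ _ _ hd.2.1]
  change e ∈ greedyStep active (greedyMatching active l₁) e ↔ _
  unfold greedyStep
  split_ifs with hc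
  · simp [hc]
  · simp [hne, hc]

/-- The sort key of an unordered pair of vertices. -/
def pairKey (t : V → I) (e : Sym2 V) : I ×ₗ I := toLex ((e.map t).inf, (e.map t).sup)

lemma pairKey_injective {t : V → I} (ht : Function.Injective t) :
    Function.Injective (pairKey t) := by
  intro e f h
  have h2 := toLex.injective h
  rw [Prod.mk.injEq] at h2
  exact Sym2.map.injective ht (Sym2.inf_eq_inf_and_sup_eq_sup.1 h2)

/-- This is the feature of the (min, max) order on which the whole recursion rests: at a fixed
vertex only the seed of the other endpoint matters. -/
lemma pairKey_lt_iff (t : V → I) (u v w : V) :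
    pairKey t s(u, w) < pairKey t s(u, v) ↔ t w < t v := by
  simp only [pairKey, Sym2.map_mk, Sym2.inf_mk, Sym2.sup_mk, Prod.Lex.toLex_lt_toLex]
  generalize t u = a
  generalize t v = b
  generalize t w = c
  grind

/-- Distinct seeds give distinct keys, so the prefix before `e` is exactly the set of edges with
smaller key, however the sort treats ties. -/
lemma mem_greedyMatching_lexOrder {t : V → I} (ht : Function.Injective t)
    (active : G.edgeSet → Bool) (e : G.edgeSet) :
    e ∈ greedyMatching active (lexOrder G t) ↔ active e = true ∧
      ∀ f : G.edgeSet, pairKey t f < pairKey t e →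
        f ∈ greedyMatching active (lexOrder G t) →
          ∀ v : V, ¬ (v ∈ (e : Sym2 V) ∧ v ∈ (f : Sym2 V)) := by
  have hperm : (lexOrder G t).Perm (Finset.univ : Finset G.edgeSet).toList :=
    List.mergeSort_perm _ _
  have hnd : (lexOrder G t).Nodup := hperm.nodup_iff.2 (Finset.nodup_toList _)
  have hmem : ∀ f, f ∈ lexOrder G t := fun f => hperm.mem_iff.2 (by simp)
  have hsort : (lexOrder G t).Pairwise (fun e f => edgeKey G t e ≤ edgeKey G t f) := by
    have := List.pairwise_mergeSort (le := fun e f => decide (edgeKey G t e ≤ edgeKey G t f))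
      (fun a b c h1 h2 => by simp only [decide_eq_true_eq] at *; exact h1.trans h2)
      (fun a b => by simpa using le_total _ _) (Finset.univ : Finset G.edgeSet).toList
    simpa [lexOrder] using this
  obtain ⟨l₁, l₂, hl⟩ := List.append_of_mem (hmem e)
  have hbefore : ∀ f : G.edgeSet, f ∈ l₁ ↔ pairKey t f < pairKey t e := by
    intro f
    rw [hl] at hsort hnd
    rw [List.pairwise_append] at hsort
    rw [List.nodup_append] at hnd
    constructor
    · intro hf
      refine lt_of_le_of_ne (hsort.2.2 f hf e (by simp)) fun h => ?_
      exact hnd.2.2 f hf e (by simp) (Subtype.ext (pairKey_injective ht h))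
    · intro hf
      have hfm := hmem f
      rw [hl] at hfm
      simp only [List.mem_append, List.mem_cons] at hfm
      rcases hfm with h | rfl | h
      · exact h
      · exact absurd hf (lt_irrefl _)
      · exact absurd hf (not_lt.2 ((List.pairwise_cons.1 hsort.2.1).1 f h))
  rw [hl] at hnd
  have := mem_greedyMatching_append active hnd
  rw [← hl] at this
  simpa only [hbefore] using this

/-- The pair `e` is an active edge. -/
def IsActive (act : G.edgeSet → Bool) (e : Sym2 V) : Prop :=
  ∃ h : e ∈ G.edgeSet, act ⟨e, h⟩ = true

open scoped Classical in
/-- The pair `e` is selected by the greedy scheme on the subgraph induced by `K`. -/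
def Selected (t : V → I) (act : G.edgeSet → Bool) (K : Finset V) (e : Sym2 V) : Prop :=
  ∃ h : e ∈ G.edgeSet, ⟨e, h⟩ ∈ greedyMatching
    (fun f => act f && decide (∀ v ∈ (f : Sym2 V), v ∈ K)) (lexOrder G t)

variable {t : V → I} {act : G.edgeSet → Bool}

lemma selected_univ (e : G.edgeSet) :
    Selected t act Finset.univ e ↔ e ∈ greedyMatching act (lexOrder G t) := by
  simp [Selected]

lemma selected_iff (ht : Function.Injective t) (K : Finset V) (e : Sym2 V) :
    Selected t act K e ↔ IsActive act e ∧ (∀ v ∈ e, v ∈ K) ∧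
      ∀ f, pairKey t f < pairKey t e → Selected t act K f → ∀ v, v ∈ e → v ∉ f := by
  unfold Selected IsActive
  constructor
  · rintro ⟨h, hm⟩
    rw [mem_greedyMatching_lexOrder ht] at hm
    simp only [Bool.and_eq_true, decide_eq_true_eq] at hm
    refine ⟨⟨h, hm.1.1⟩, hm.1.2, ?_⟩
    rintro f hf ⟨hfe, hfm⟩ v hv hv'
    exact hm.2 ⟨f, hfe⟩ hf hfm v ⟨hv, hv'⟩
  · rintro ⟨⟨h, ha⟩, hK, hf⟩
    refine ⟨h, ?_⟩
    rw [mem_greedyMatching_lexOrder ht]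
    simp only [Bool.and_eq_true, decide_eq_true_eq]
    exact ⟨⟨ha, hK⟩, fun f hfk hfm v hv => hf f hfk ⟨f.2, hfm⟩ v hv.1 hv.2⟩

/-- Vertex `u` is not matched inside `K` to a vertex with seed smaller than `b`. -/
def IsFree (t : V → I) (act : G.edgeSet → Bool) (K : Finset V) (u : V) (b : I) : Prop :=
  ∀ w, Selected t act K s(u, w) → ¬ t w < b

lemma isFree_iff {K : Finset V} {u v : V} :
    IsFree t act K u (t v) ↔
      ∀ f, pairKey t f < pairKey t s(u, v) → Selected t act K f → u ∉ f := by
  constructor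
  · rintro h f hf hs hu
    obtain ⟨w, rfl⟩ := hu
    exact h w hs ((pairKey_lt_iff _ _ _ _).1 hf)
  · intro h w hs hlt
    exact h _ ((pairKey_lt_iff _ _ _ _).2 hlt) hs (by simp)

lemma wellFounded_pairKey (t : V → I) :
    WellFounded (fun e f : Sym2 V => pairKey t e < pairKey t f) :=
  haveI : IsTrans (Sym2 V) (fun e f => pairKey t e < pairKey t f) := ⟨fun _ _ _ => lt_trans⟩
  haveI : Std.Irrefl (fun e f : Sym2 V => pairKey t e < pairKey t f) := ⟨fun _ => lt_irrefl _⟩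
  Finite.wellFounded_of_trans_of_irrefl _

/-- A vertex still unmatched at time `k` has blocked nothing, so its deletion leaves all other
decisions up to `k` unchanged. -/
lemma selected_erase_iff (ht : Function.Injective t) {K : Finset V} {v : V} {k : I ×ₗ I}
    (h : ∀ f, pairKey t f < k → Selected t act K f → v ∉ f) (f : Sym2 V) (hv : v ∉ f)
    (hf : pairKey t f ≤ k) : Selected t act K f ↔ Selected t act (K.erase v) f := by
  induction f using (wellFounded_pairKey t).induction with
  | _ f ih =>
    have hmem : (∀ w ∈ f, w ∈ K) ↔ ∀ w ∈ f, w ∈ K.erase v := by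
      refine forall₂_congr fun w hw => ?_
      have : w ≠ v := fun h => hv (h ▸ hw)
      simp [this]
    rw [selected_iff ht, selected_iff ht (K.erase v), hmem]
    refine and_congr_right fun _ => and_congr_right fun _ => forall₂_congr fun g hg => ?_
    by_cases hvg : v ∈ g
    · have h1 : ¬ Selected t act K g := fun hs => h g (hg.trans_le hf) hs hvg
      have h2 : ¬ Selected t act (K.erase v) g := fun hs =>
        absurd (((selected_iff ht _ _).1 hs).2.1 v hvg) (by simp)
      simp [h1, h2]
    · rw [ih g hg hvg (hg.le.trans hf)]

/-- Deleting an endpoint that is unmatched so far does not affect the other one, so the freeness of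
each can be tested in the graph without the other. This decouples the two endpoints. -/
lemma selected_mk_iff (ht : Function.Injective t) {K : Finset V} {u v : V} (hu : u ∈ K)
    (hv : v ∈ K) : Selected t act K s(u, v) ↔
      IsActive act s(u, v) ∧ IsFree t act (K.erase v) u (t v) ∧ IsFree t act (K.erase u) v (t u) := by
  have hsymm : pairKey t s(v, u) = pairKey t s(u, v) := by rw [Sym2.eq_swap]
  rw [isFree_iff, isFree_iff, hsymm]
  constructor
  · intro hs
    obtain ⟨ha, -, hfr⟩ := (selected_iff ht _ _).1 hs
    refine ⟨ha, fun f hf hsf huf => ?_, fun f hf hsf hvf => ?_⟩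
    · have hvf : v ∉ f := fun h => absurd (((selected_iff ht _ _).1 hsf).2.1 v h) (by simp)
      have := (selected_erase_iff ht (k := pairKey t s(u, v))
        (fun g hg hsg => hfr g hg hsg v (by simp)) f hvf hf.le).2 hsf
      exact hfr f hf this u (by simp) huf
    · have huf : u ∉ f := fun h => absurd (((selected_iff ht _ _).1 hsf).2.1 u h) (by simp)
      have := (selected_erase_iff ht (k := pairKey t s(u, v))
        (fun g hg hsg => hfr g hg hsg u (by simp)) f huf hf.le).2 hsf
      exact hfr f hf this v (by simp) hvf
  · rintro ⟨ha, hfu, hfv⟩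
    rw [selected_iff ht]
    refine ⟨ha, by simp [hu, hv], ?_⟩
    intro f
    -- Induction on the key: as long as no earlier selected edge meets `u` or `v`, one endpoint may
    -- be deleted, and then the freeness hypothesis on the other applies.
    induction f using (wellFounded_pairKey t).induction with
    | _ f ih =>
      intro hf hsf w hw hwf
      have hne : f ≠ s(u, v) := fun h => by simp [h] at hf
      have hnot : ¬ (u ∈ f ∧ v ∈ f) := fun h => by
        by_cases huv : u = v
        · subst huv
          exact ((mem_edge_ne ha)) rfl
        · exact hne (((Sym2.mem_and_mem_iff huv).1 h))
      rw [Sym2.mem_iff] at hw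
      rcases hw with rfl | rfl
      · have hvf : v ∉ f := fun h => hnot ⟨hwf, h⟩
        exact hfu f hf ((selected_erase_iff ht (k := pairKey t f)
          (fun g hg hsg => ih g hg (hg.trans hf) hsg v (by simp)) f hvf le_rfl).1 hsf) hwf
      · have huf : u ∉ f := fun h => hnot ⟨h, hwf⟩
        exact hfv f hf ((selected_erase_iff ht (k := pairKey t f)
          (fun g hg hsg => ih g hg (hg.trans hf) hsg u (by simp)) f huf le_rfl).1 hsf) hwf
where
  mem_edge_ne {u v : V} (h : IsActive act s(u, v)) : u ≠ v := by
    obtain ⟨h, -⟩ := h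
    exact h.ne

/-- If `u` is still free when an active edge to `w` arrives, only an earlier match of `w` can
prevent selection, and that match is made in `K`, since `u` has not interfered. Iterating this gives
the recursion for `freeInd`. -/
lemma isFree_insert_iff (ht : Function.Injective t) {K : Finset V} {u v : V} (hu : u ∉ K) :
    IsFree t act (insert u K) u (t v) ↔
      ∀ w ∈ K, IsActive act s(u, w) → t w < t v → ¬ IsFree t act K w (t u) := by
  have he : (insert u K).erase u = K := Finset.erase_insert hu
  constructor
  · intro hfree w hw ha hlt hfw
    have huw : u ≠ w := fun h => hu (h ▸ hw)
    refine hfree w ?_ hlt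
    rw [selected_mk_iff ht (by simp) (by simp [hw]), he]
    refine ⟨ha, ?_, hfw⟩
    have hfu : ∀ f, pairKey t f < pairKey t s(u, w) → Selected t act (insert u K) f → u ∉ f := by
      refine isFree_iff.1 fun z hz hzw => hfree z hz (hzw.trans hlt)
    have hwfree : ∀ f, pairKey t f < pairKey t s(u, w) → Selected t act (insert u K) f → w ∉ f := by
      intro f hf hs hwf
      have := (selected_erase_iff ht hfu f (hfu f hf hs) hf.le).1 hs
      rw [he] at this
      exact isFree_iff.1 hfw f (by rwa [Sym2.eq_swap] at hf) this hwf
    refine isFree_iff.2 fun f hf hs huf => ?_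
    have hwf : w ∉ f := fun h => absurd (((selected_iff ht _ _).1 hs).2.1 w h) (by simp)
    exact hfu f hf ((selected_erase_iff ht hwfree f hwf hf.le).2 hs) huf
  · intro h w hs hlt
    have hsel := (selected_iff ht _ _).1 hs
    have huw : w ≠ u := fun h => by
      obtain ⟨hh, -⟩ := hsel.1
      exact hh.ne h.symm
    have hw : w ∈ K := by simpa [huw] using hsel.2.1 w (by simp)
    rw [selected_mk_iff ht (by simp) (by simp [hw]), he] at hs
    exact h w hw hs.1 hlt hs.2.2

end Greedy

/-! ### The indicator that a vertex is still free -/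

section FreeIndicator

variable {V : Type*} [Fintype V] [DecidableEq V] {G : SimpleGraph V} [DecidableRel G.Adj]

open scoped Classical in
/-- The indicator of the event that the pair `e` is an active edge. -/
def activeInd (act : G.edgeSet → Bool) (e : Sym2 V) : ℝ := if IsActive act e then 1 else 0

lemma activeInd_nonneg (act : G.edgeSet → Bool) (e : Sym2 V) : 0 ≤ activeInd act e := by
  unfold activeInd; split_ifs <;> simp

lemma activeInd_le_one (act : G.edgeSet → Bool) (e : Sym2 V) : activeInd act e ≤ 1 := by
  unfold activeInd; split_ifs <;> simp

lemma activeInd_congr {act act' : G.edgeSet → Bool} {e : Sym2 V}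
    (h : ∀ he : e ∈ G.edgeSet, act ⟨e, he⟩ = act' ⟨e, he⟩) :
    activeInd act e = activeInd act' e := by
  have : IsActive act e ↔ IsActive act' e := exists_congr fun he => by rw [h he]
  simp only [activeInd]
  split_ifs <;> simp_all

lemma measurable_activeInd (e : Sym2 V) :
    Measurable fun act : G.edgeSet → Bool => activeInd act e := by
  by_cases he : e ∈ G.edgeSet
  · have : (fun act : G.edgeSet → Bool => activeInd act e) =
        (fun c : Bool => if c then (1 : ℝ) else 0) ∘ fun act => act ⟨e, he⟩ := by
      ext act
      simp [activeInd, IsActive, he]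
    rw [this]
    exact (measurable_of_finite _).comp (measurable_pi_apply _)
  · have : (fun act : G.edgeSet → Bool => activeInd act e) = fun _ => 0 := by
      ext act
      simp [activeInd, IsActive, he]
    rw [this]
    exact measurable_const

/-- The indicator that `u`, if it had seed `a` and were added to the graph induced by `K`, would
not be matched there to a vertex with seed smaller than `b`. -/
def freeInd (K : Finset V) (u : V) (a b : I) (ω : (V → I) × (G.edgeSet → Bool)) : ℝ :=
  ∏ w ∈ K.attach, (1 - activeInd ω.2 s(u, w) *
    (if ω.1 w < b then freeInd (K.erase w) w (ω.1 w) a ω else 0))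
termination_by K.card
decreasing_by exact Finset.card_erase_lt_of_mem w.2

/-- The indicator that `w ∈ K` has a seed smaller than `b` and is still free when an edge to a
vertex with seed `a` arrives. -/
def offerInd (K : Finset V) (w : V) (a b : I) (ω : (V → I) × (G.edgeSet → Bool)) : ℝ :=
  if ω.1 w < b then freeInd (K.erase w) w (ω.1 w) a ω else 0

lemma freeInd_eq (K : Finset V) (u : V) (a b : I) (ω : (V → I) × (G.edgeSet → Bool)) :
    freeInd K u a b ω = ∏ w ∈ K, (1 - activeInd ω.2 s(u, w) * offerInd K w a b ω) := by
  rw [freeInd]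
  exact Finset.prod_attach K (fun w => 1 - activeInd ω.2 s(u, w) * offerInd K w a b ω)

lemma freeInd_mem_Icc (K : Finset V) (u : V) (a b : I) (ω : (V → I) × (G.edgeSet → Bool)) :
    freeInd K u a b ω ∈ Set.Icc (0 : ℝ) 1 := by
  induction hn : K.card using Nat.strong_induction_on generalizing K u a b with
  | _ n ih =>
    have hq : ∀ w ∈ K, offerInd K w a b ω ∈ Set.Icc (0 : ℝ) 1 := by
      intro w hw
      unfold offerInd
      split_ifs
      · exact ih _ (hn ▸ Finset.card_erase_lt_of_mem hw) _ _ _ _ rfl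
      · simp
    have h1 : ∀ w ∈ K, 1 - activeInd ω.2 s(u, w) * offerInd K w a b ω ∈ Set.Icc (0 : ℝ) 1 := by
      intro w hw
      have := hq w hw
      have h2 := mul_nonneg (activeInd_nonneg ω.2 s(u, w)) this.1
      have h3 := mul_le_one₀ (activeInd_le_one ω.2 s(u, w)) this.1 this.2
      constructor <;> linarith
    rw [freeInd_eq]
    exact ⟨Finset.prod_nonneg fun w hw => (h1 w hw).1,
      Finset.prod_le_one (fun w hw => (h1 w hw).1) fun w hw => (h1 w hw).2⟩

lemma offerInd_mem_Icc (K : Finset V) (w : V) (a b : I) (ω : (V → I) × (G.edgeSet → Bool)) :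
    offerInd K w a b ω ∈ Set.Icc (0 : ℝ) 1 := by
  unfold offerInd
  split_ifs
  · exact freeInd_mem_Icc _ _ _ _ _
  · simp

/-- Source of the independence statements below: the seed of the root enters only through the
argument `a`, so for `u ∉ K` it may be resampled, as may seeds outside `K` and states of edges
leaving `insert u K`. -/
lemma freeInd_congr {K : Finset V} {u : V} {a b : I} {ω ω' : (V → I) × (G.edgeSet → Bool)}
    (ht : ∀ w ∈ K, ω.1 w = ω'.1 w)
    (hb : ∀ w ∈ K, ∀ z ∈ insert u K, activeInd ω.2 s(z, w) = activeInd ω'.2 s(z, w)) :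
    freeInd K u a b ω = freeInd K u a b ω' := by
  induction hn : K.card using Nat.strong_induction_on generalizing K u a b with
  | _ n ih =>
    rw [freeInd_eq, freeInd_eq]
    refine Finset.prod_congr rfl fun w hw => ?_
    rw [hb w hw u (by simp)]
    unfold offerInd
    rw [ht w hw, ih _ (hn ▸ Finset.card_erase_lt_of_mem hw) (K := K.erase w) (u := w) ?_ ?_ rfl]
    · exact fun z hz => ht z (Finset.mem_of_mem_erase hz)
    · intro z hz y hy
      rw [Finset.insert_erase hw] at hy
      exact hb z (Finset.mem_of_mem_erase hz) y (by simp [hy])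

lemma measurable_freeInd {β : Type*} [MeasurableSpace β] (K : Finset V) (u : V) {a b : β → I}
    {ω : β → (V → I) × (G.edgeSet → Bool)} (ha : Measurable a) (hb : Measurable b)
    (hω : Measurable ω) : Measurable fun p => freeInd K u (a p) (b p) (ω p) := by
  induction hn : K.card using Nat.strong_induction_on generalizing K u a b with
  | _ n ih =>
    simp_rw [freeInd_eq]
    refine Finset.measurable_prod _ fun w hw => ?_
    have hw' : Measurable fun p => (ω p).1 w := (measurable_pi_apply w).comp hω.fst
    refine measurable_const.sub (((measurable_activeInd _).comp hω.snd).mul ?_)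
    unfold offerInd
    exact Measurable.ite (measurableSet_lt hw' hb)
      (ih _ (hn ▸ Finset.card_erase_lt_of_mem hw) _ _ hw' ha rfl) measurable_const

lemma measurable_offerInd {β : Type*} [MeasurableSpace β] (K : Finset V) (w : V) {a b : β → I}
    {ω : β → (V → I) × (G.edgeSet → Bool)} (ha : Measurable a) (hb : Measurable b)
    (hω : Measurable ω) : Measurable fun p => offerInd K w (a p) (b p) (ω p) := by
  have hw' : Measurable fun p => (ω p).1 w := (measurable_pi_apply w).comp hω.fst
  unfold offerInd
  exact Measurable.ite (measurableSet_lt hw' hb) (measurable_freeInd _ _ hw' ha hω)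
    measurable_const

open scoped Classical in
lemma freeInd_eq_ite {t : V → I} {act : G.edgeSet → Bool} (ht : Function.Injective t)
    (K : Finset V) {u : V} (hu : u ∉ K) (v : V) :
    freeInd K u (t u) (t v) (t, act) = if IsFree t act (insert u K) u (t v) then 1 else 0 := by
  induction hn : K.card using Nat.strong_induction_on generalizing K u v with
  | _ n ih =>
    have hoff : ∀ w ∈ K, offerInd K w (t u) (t v) (t, act) =
        if t w < t v ∧ IsFree t act K w (t u) then 1 else 0 := by
      intro w hw
      unfold offerInd
      rw [ih _ (hn ▸ Finset.card_erase_lt_of_mem hw) _ (by simp) u rfl, Finset.insert_erase hw]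
      dsimp only
      split_ifs <;> simp_all
    rw [freeInd_eq, isFree_insert_iff ht hu]
    have hfac : ∀ w ∈ K, 1 - activeInd act s(u, w) * offerInd K w (t u) (t v) (t, act) =
        if (IsActive act s(u, w) → t w < t v → ¬ IsFree t act K w (t u)) then (1 : ℝ) else 0 := by
      intro w hw
      rw [hoff w hw]
      unfold activeInd
      split_ifs <;> simp_all
    rw [Finset.prod_congr rfl hfac, Finset.prod_ite_zero]
    simp

/-- Selection of an edge in terms of free indicators. -/
lemma mem_greedyMatching_of_freeInd {t : V → I} {act : G.edgeSet → Bool}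
    (ht : Function.Injective t) {e : G.edgeSet} {u v : V} (he : (e : Sym2 V) = s(u, v))
    (h : activeInd act s(u, v) * (freeInd ((Finset.univ.erase u).erase v) u (t u) (t v) (t, act) *
      freeInd ((Finset.univ.erase u).erase v) v (t v) (t u) (t, act)) ≠ 0) :
    e ∈ greedyMatching act (lexOrder G t) := by
  have huv : u ≠ v := by
    have h2 := e.2
    rw [he] at h2
    exact (G.mem_edgeSet.1 h2).ne
  have h1 := left_ne_zero_of_mul h
  have h2 := left_ne_zero_of_mul (right_ne_zero_of_mul h)
  have h3 := right_ne_zero_of_mul (right_ne_zero_of_mul h)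
  rw [freeInd_eq_ite ht _ (by simp)] at h2 h3
  unfold activeInd at h1
  simp only [ne_eq, ite_eq_right_iff, one_ne_zero, imp_false, not_not] at h1 h2 h3
  rw [Finset.insert_erase (by simp [huv.symm])] at h3
  rw [Finset.erase_right_comm, Finset.insert_erase (by simp [huv])] at h2
  rw [← selected_univ, he, selected_mk_iff ht (by simp) (by simp)]
  exact ⟨h1, h2, h3⟩

end FreeIndicator

/-! ### Resampling one coordinate -/

section Resampling

/-- Independence in a usable form: overwriting one coordinate by an independent copy preserves the
product law, so that coordinate can be integrated out with the others fixed. -/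
lemma measurePreserving_update {ι : Type*} [Fintype ι] [DecidableEq ι] {α : ι → Type*}
    [∀ i, MeasurableSpace (α i)] (μ : ∀ i, Measure (α i)) [∀ i, IsProbabilityMeasure (μ i)]
    (i : ι) : MeasurePreserving (fun p : α i × (∀ j, α j) => Function.update p.2 i p.1)
      ((μ i).prod (Measure.pi μ)) (Measure.pi μ) := by
  have hm : Measurable fun p : α i × (∀ j, α j) => Function.update p.2 i p.1 := by
    refine measurable_pi_iff.2 fun j => ?_
    by_cases h : j = i
    · subst h
      simpa using measurable_fst
    · simp only [Function.update_of_ne h]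
      exact (measurable_pi_apply j).comp measurable_snd
  refine ⟨hm, (Measure.pi_eq fun s hs => ?_).symm⟩
  rw [Measure.map_apply hm (MeasurableSet.univ_pi hs)]
  have hpre : (fun p : α i × (∀ j, α j) => Function.update p.2 i p.1) ⁻¹' Set.univ.pi s =
      s i ×ˢ Set.univ.pi (Function.update s i Set.univ) := by
    ext p
    simp only [Set.mem_preimage, Set.mem_pi, Set.mem_univ, true_implies, Set.mem_prod]
    constructor
    · intro h
      refine ⟨by simpa using h i, fun j => ?_⟩
      by_cases hj : j = i
      · subst hj; simp
      · simpa [hj] using h j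
    · rintro ⟨h1, h2⟩ j
      by_cases hj : j = i
      · subst hj; simpa using h1
      · simpa [hj] using h2 j
  rw [hpre, Measure.prod_prod, Measure.pi_pi, ← Finset.mul_prod_erase _ _ (Finset.mem_univ i),
    ← Finset.mul_prod_erase Finset.univ (fun j => μ j (s j)) (Finset.mem_univ i)]
  simp only [Function.update_self, measure_univ, one_mul]
  congr 1
  refine Finset.prod_congr rfl fun j hj => ?_
  rw [Function.update_of_ne (Finset.ne_of_mem_erase hj)]

variable {V : Type*} [Fintype V] [DecidableEq V] {G : SimpleGraph V} [DecidableRel G.Adj]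

instance (x : G.edgeSet → I) : IsProbabilityMeasure (law x) := by
  unfold law; infer_instance

/-- The value of the pair `e`, which is zero when `e` is not an edge. -/
def edgeWeight (x : G.edgeSet → I) (e : Sym2 V) : ℝ :=
  if h : e ∈ G.edgeSet then x ⟨e, h⟩ else 0

lemma edgeWeight_coe (x : G.edgeSet → I) (e : G.edgeSet) : edgeWeight x e = x e := by
  simp [edgeWeight]

lemma edgeWeight_nonneg (x : G.edgeSet → I) (e : Sym2 V) : 0 ≤ edgeWeight x e := by
  unfold edgeWeight
  split_ifs with h
  · exact (x ⟨e, h⟩).2.1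
  · exact le_rfl

lemma edgeWeight_le_one (x : G.edgeSet → I) (e : Sym2 V) : edgeWeight x e ≤ 1 := by
  unfold edgeWeight
  split_ifs with h
  · exact (x ⟨e, h⟩).2.2
  · exact zero_le_one

/-- `X` does not depend on the state of `e`. -/
def EdgeFree (X : (V → I) × (G.edgeSet → Bool) → ℝ) (e : Sym2 V) : Prop :=
  ∀ t act act', (∀ f : G.edgeSet, (f : Sym2 V) ≠ e → act f = act' f) → X (t, act) = X (t, act')

/-- `X` does not depend on the seed of `w`. -/
def SeedFree (X : (V → I) × (G.edgeSet → Bool) → ℝ) (w : V) : Prop :=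
  ∀ t t' act, (∀ v, v ≠ w → t v = t' v) → X (t, act) = X (t', act)

lemma integrable_of_abs_le {β : Type*} [MeasurableSpace β] {μ : Measure β} [IsFiniteMeasure μ]
    {X : β → ℝ} (hX : Measurable X) {C : ℝ} (hC : ∀ ω, |X ω| ≤ C) : Integrable X μ :=
  Integrable.of_bound hX.aestronglyMeasurable C (Eventually.of_forall hC)

lemma integral_activeInd_mul (x : G.edgeSet → I) (e : Sym2 V)
    {X : (V → I) × (G.edgeSet → Bool) → ℝ} (hX : Measurable X) {C : ℝ} (hC : ∀ ω, |X ω| ≤ C)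
    (hf : EdgeFree X e) :
    ∫ ω, activeInd ω.2 e * X ω ∂law x = edgeWeight x e * ∫ ω, X ω ∂law x := by
  by_cases he : e ∈ G.edgeSet
  · have hbX : Measurable fun ω : (V → I) × (G.edgeSet → Bool) => activeInd ω.2 e * X ω :=
      ((measurable_activeInd e).comp measurable_snd).mul hX
    have hbC : ∀ ω : (V → I) × (G.edgeSet → Bool), |activeInd ω.2 e * X ω| ≤ C := by
      intro ω
      rw [abs_mul, abs_of_nonneg (activeInd_nonneg _ _)]
      exact (mul_le_of_le_one_left (abs_nonneg _) (activeInd_le_one _ _)).trans (hC ω)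
    unfold law
    rw [integral_prod _ (integrable_of_abs_le hbX hbC), integral_prod _ (integrable_of_abs_le hX hC),
      ← integral_const_mul]
    refine integral_congr_ae (Eventually.of_forall fun t => ?_)
    have hmp := measurePreserving_update
      (fun f : G.edgeSet => bernoulliMeasure true false (x f)) ⟨e, he⟩
    dsimp only
    conv_lhs => rw [← hmp.map_eq]
    have hbXt : Measurable fun act : G.edgeSet → Bool => activeInd act e * X (t, act) :=
      hbX.comp (measurable_prodMk_left (x := t))
    rw [integral_map hmp.measurable.aemeasurable hbXt.aestronglyMeasurable]
    have : ∀ p : Bool × (G.edgeSet → Bool),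
        activeInd (Function.update p.2 ⟨e, he⟩ p.1) e *
          X (t, Function.update p.2 ⟨e, he⟩ p.1) = (if p.1 then (1 : ℝ) else 0) * X (t, p.2) := by
      intro p
      congr 1
      · simp [activeInd, IsActive, he]
      · refine hf _ _ _ fun f hfe => ?_
        rw [Function.update_of_ne]
        rintro rfl
        exact hfe rfl
    simp_rw [this]
    rw [integral_prod_mul (fun b : Bool => if b then (1 : ℝ) else 0) (fun act => X (t, act)),
      integral_bernoulliMeasure]
    simp [edgeWeight, he]
  · simp [activeInd, IsActive, edgeWeight, he]

/-- The product is affine in each edge state, so the states can be replaced by their means one at a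
time. The factor `X` is kept general so that it can absorb the factors already averaged. -/
lemma integral_prod_activeInd (x : G.edgeSet → I) {L : Finset V} {u : V}
    {Q : V → (V → I) × (G.edgeSet → Bool) → ℝ} (hQ : ∀ z, Measurable (Q z))
    (hQ1 : ∀ z ω, Q z ω ∈ Set.Icc (0 : ℝ) 1) (hQf : ∀ z ∈ L, ∀ y ∈ L, EdgeFree (Q y) s(u, z))
    {X : (V → I) × (G.edgeSet → Bool) → ℝ} (hX : Measurable X) (hX1 : ∀ ω, |X ω| ≤ 1)
    (hXf : ∀ z ∈ L, EdgeFree X s(u, z)) :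
    ∫ ω, (∏ z ∈ L, (1 - activeInd ω.2 s(u, z) * Q z ω)) * X ω ∂law x =
      ∫ ω, (∏ z ∈ L, (1 - edgeWeight x s(u, z) * Q z ω)) * X ω ∂law x := by
  have hfac : ∀ (c : ℝ) z ω, 0 ≤ c → c ≤ 1 → |1 - c * Q z ω| ≤ 1 := by
    intro c z ω h0 h1
    have := mul_nonneg h0 (hQ1 z ω).1
    have := mul_le_one₀ h1 (hQ1 z ω).1 (hQ1 z ω).2
    rw [abs_le]
    constructor <;> linarith
  induction L using Finset.induction_on generalizing X with
  | empty => simp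
  | insert z J hz ih =>
    set Y : (V → I) × (G.edgeSet → Bool) → ℝ :=
      fun ω => (∏ y ∈ J, (1 - activeInd ω.2 s(u, y) * Q y ω)) * X ω with hY
    have hmeasb : ∀ y, Measurable fun ω : (V → I) × (G.edgeSet → Bool) => activeInd ω.2 s(u, y) :=
      fun y => (measurable_activeInd _).comp measurable_snd
    have hYm : Measurable Y :=
      (Finset.measurable_prod _ fun y _ => measurable_const.sub ((hmeasb y).mul (hQ y))).mul hX
    have hY1 : ∀ ω, |Y ω| ≤ 1 := by
      intro ω
      rw [hY]
      dsimp only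
      rw [abs_mul, Finset.abs_prod]
      refine mul_le_one₀ (Finset.prod_le_one (fun _ _ => abs_nonneg _) fun y _ => ?_)
        (abs_nonneg _) (hX1 ω)
      exact hfac _ _ _ (activeInd_nonneg _ _) (activeInd_le_one _ _)
    have hYf : EdgeFree Y s(u, z) := by
      intro t act act' h
      rw [hY]
      dsimp only
      rw [hXf z (by simp) t act act' h]
      congr 1
      refine Finset.prod_congr rfl fun y hy => ?_
      rw [hQf z (by simp) y (by simp [hy]) t act act' h]
      congr 2
      refine activeInd_congr fun he => h _ fun hyz => hz ?_
      exact Sym2.congr_right.1 hyz ▸ hy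
    have hQYm : Measurable fun ω => Q z ω * Y ω := (hQ z).mul hYm
    have hQY1 : ∀ ω, |Q z ω * Y ω| ≤ 1 := by
      intro ω
      rw [abs_mul]
      refine mul_le_one₀ ?_ (abs_nonneg _) (hY1 ω)
      rw [abs_of_nonneg (hQ1 z ω).1]
      exact (hQ1 z ω).2
    have hQYf : EdgeFree (fun ω => Q z ω * Y ω) s(u, z) := by
      intro t act act' h
      dsimp only
      rw [hYf t act act' h, hQf z (by simp) z (by simp) t act act' h]
    have hint : Integrable (fun ω => activeInd ω.2 s(u, z) * (Q z ω * Y ω)) (law x) := by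
      refine integrable_of_abs_le ((hmeasb z).mul hQYm) (C := 1) fun ω => ?_
      rw [abs_mul, abs_of_nonneg (activeInd_nonneg _ _)]
      exact mul_le_one₀ (activeInd_le_one _ _) (abs_nonneg _) (hQY1 ω)
    have step : ∫ ω, (∏ y ∈ insert z J, (1 - activeInd ω.2 s(u, y) * Q y ω)) * X ω ∂law x =
        ∫ ω, (∏ y ∈ J, (1 - activeInd ω.2 s(u, y) * Q y ω)) *
          ((1 - edgeWeight x s(u, z) * Q z ω) * X ω) ∂law x := by
      calc _ = ∫ ω, (Y ω - activeInd ω.2 s(u, z) * (Q z ω * Y ω)) ∂law x := by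
            refine integral_congr_ae (Eventually.of_forall fun ω => ?_)
            dsimp only
            rw [Finset.prod_insert hz, hY]
            ring
        _ = ∫ ω, Y ω ∂law x - edgeWeight x s(u, z) * ∫ ω, Q z ω * Y ω ∂law x := by
            rw [integral_sub (integrable_of_abs_le hYm hY1) hint,
              integral_activeInd_mul x _ hQYm hQY1 hQYf]
        _ = ∫ ω, (Y ω - edgeWeight x s(u, z) * (Q z ω * Y ω)) ∂law x := by
            rw [integral_sub (integrable_of_abs_le hYm hY1)
              ((integrable_of_abs_le hQYm hQY1).const_mul _), integral_const_mul]
        _ = _ := by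
            refine integral_congr_ae (Eventually.of_forall fun ω => ?_)
            dsimp only
            rw [hY]
            ring
    have hX' : Measurable fun ω => (1 - edgeWeight x s(u, z) * Q z ω) * X ω :=
      (measurable_const.sub (measurable_const.mul (hQ z))).mul hX
    rw [step, ih (fun a ha b hb => hQf a (by simp [ha]) b (by simp [hb])) hX']
    · refine integral_congr_ae (Eventually.of_forall fun ω => ?_)
      dsimp only
      rw [Finset.prod_insert hz]
      ring
    · intro ω
      rw [abs_mul]
      exact mul_le_one₀ (hfac _ _ _ (edgeWeight_nonneg _ _) (edgeWeight_le_one _ _))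
        (abs_nonneg _) (hX1 ω)
    · intro y hy t act act' h
      dsimp only
      rw [hXf y (by simp [hy]) t act act' h, hQf y (by simp [hy]) z (by simp) t act act' h]

lemma measurePreserving_update_seed (x : G.edgeSet → I) (w : V) :
    MeasurePreserving (fun p : I × ((V → I) × (G.edgeSet → Bool)) =>
      (Function.update p.2.1 w p.1, p.2.2)) ((volume : Measure I).prod (law x)) (law x) := by
  unfold law
  exact ((measurePreserving_update (fun _ : V => (volume : Measure I)) w).prod
    (MeasurePreserving.id _)).comp (measurePreserving_prodAssoc _ _ _).symm

/-- Integrating out the seed of `w`. -/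
lemma integral_seed (x : G.edgeSet → I) (w : V) {Y : I → (V → I) × (G.edgeSet → Bool) → ℝ}
    (hY : Measurable (Function.uncurry Y)) {C : ℝ} (hC : ∀ c ω, |Y c ω| ≤ C)
    (hf : ∀ c, SeedFree (Y c) w) :
    ∫ ω, Y (ω.1 w) ω ∂law x = ∫ ω, (∫ c, Y c ω) ∂law x := by
  have hmp := measurePreserving_update_seed x w
  have hpair : Measurable fun ω : (V → I) × (G.edgeSet → Bool) => (ω.1 w, ω) :=
    ((measurable_pi_apply w).comp measurable_fst).prodMk measurable_id
  have hm : Measurable fun ω : (V → I) × (G.edgeSet → Bool) => Y (ω.1 w) ω := hY.comp hpair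
  conv_lhs => rw [← hmp.map_eq]
  rw [integral_map hmp.measurable.aemeasurable hm.aestronglyMeasurable]
  have : ∀ p : I × ((V → I) × (G.edgeSet → Bool)),
      Y ((Function.update p.2.1 w p.1, p.2.2).1 w) (Function.update p.2.1 w p.1, p.2.2) =
        Function.uncurry Y p := by
    intro p
    simp only [Function.update_self, Function.uncurry]
    refine hf _ _ _ _ fun v hv => ?_
    simp [hv]
  simp_rw [this]
  rw [integral_prod_symm _ (integrable_of_abs_le hY fun p => hC p.1 p.2)]
  rfl

lemma integral_seed_swap (x : G.edgeSet → I) (w : V)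
    {Y : I → (V → I) × (G.edgeSet → Bool) → ℝ}
    (hY : Measurable (Function.uncurry Y)) {C : ℝ} (hC : ∀ c ω, |Y c ω| ≤ C)
    (hf : ∀ c, SeedFree (Y c) w) :
    ∫ ω, Y (ω.1 w) ω ∂law x = ∫ c, (∫ ω, Y c ω ∂law x) := by
  rw [integral_seed x w hY hC hf]
  exact (integral_integral_swap (integrable_of_abs_le hY fun p => hC p.1 p.2)).symm

end Resampling

/-! ### The limiting free probabilities -/

section Calculus

lemma integral_ite_lt (h : ℝ → ℝ) (b : I) :
    ∫ c : I, (if c < b then h c else 0) = ∫ c in (0 : ℝ)..b, h c := by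
  have h1 := unitInterval.measurePreserving_coe.integral_comp
    unitInterval.measurableEmbedding_coe (fun c : ℝ => (Set.Iio (b : ℝ)).indicator h c)
  have h2 : ∀ c : I, (if c < b then h c else 0) = (Set.Iio (b : ℝ)).indicator h c := by
    intro c
    simp [Set.indicator_apply]
  simp_rw [h2]
  rw [h1, setIntegral_indicator measurableSet_Iio, intervalIntegral.integral_of_le b.2.1,
    ← integral_Ico_eq_integral_Ioc]
  congr 2
  ext c
  simp only [Set.mem_inter_iff, Set.mem_Icc, Set.mem_Iio, Set.mem_Ico]
  exact ⟨fun h => ⟨h.1.1, h.2⟩, fun h => ⟨⟨h.1, h.2.le.trans b.2.2⟩, h.2⟩⟩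

lemma integral_unitInterval_eq (h : ℝ → ℝ) : ∫ c : I, h c = ∫ c in (0 : ℝ)..1, h c := by
  rw [unitInterval.measurePreserving_coe.integral_comp unitInterval.measurableEmbedding_coe h,
    intervalIntegral.integral_of_le zero_le_one, ← integral_Icc_eq_integral_Ioc]

/-- The exponential weight of a pair of seeds. -/
def seedWeight (a b : I) : ℝ := Real.exp (2 * ((a : ℝ) + b))

lemma one_le_seedWeight (a b : I) : 1 ≤ seedWeight a b :=
  Real.one_le_exp (by have := a.2.1; have := b.2.1; linarith)

lemma seedWeight_le (a b : I) : seedWeight a b ≤ Real.exp 4 :=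
  Real.exp_le_exp.2 (by have := a.2.2; have := b.2.2; linarith)

lemma measurable_seedWeight : Measurable fun p : I × I => seedWeight p.1 p.2 := by
  unfold seedWeight
  fun_prop

/-- The rate `2` in the exponent produces the factor `1/2`, and `exp (2 * a) ≥ 1` gives the `-1`.
This contraction is what closes both inductions on the vertex set. -/
lemma integral_seedWeight_le (a b : I) :
    ∫ c : I, (if c < b then seedWeight c a else 0) ≤ (seedWeight a b - 1) / 2 := by
  have h := integral_ite_lt (fun c => Real.exp (2 * (c + (a : ℝ)))) b
  have h2 : ∫ c in (0 : ℝ)..b, Real.exp (2 * (c + (a : ℝ))) =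
      Real.exp (2 * ((b : ℝ) + a)) / 2 - Real.exp (2 * (0 + (a : ℝ))) / 2 := by
    refine intervalIntegral.integral_eq_sub_of_hasDerivAt
      (f := fun c : ℝ => Real.exp (2 * (c + (a : ℝ))) / 2) (fun c _ => ?_)
      (by apply Continuous.intervalIntegrable; fun_prop)
    have := ((((hasDerivAt_id c).add_const (a : ℝ)).const_mul 2).exp).div_const 2
    refine this.congr_deriv ?_
    simp
  unfold seedWeight
  rw [h, h2]
  have : 1 ≤ Real.exp (2 * (0 + (a : ℝ))) := Real.one_le_exp (by have := a.2.1; linarith)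
  rw [add_comm (b : ℝ)]
  linarith

/-- The limiting probability that a vertex with seed `a` is not matched before a vertex with
seed `b` is offered to it. -/
def freeProb (a b : I) : ℝ := Real.exp a / (Real.exp a + Real.exp b - 1)

/-- The limiting expected number of offers to a vertex with seed `a` from vertices with seed
smaller than `b`. -/
def offerRate (a b : I) : ℝ := Real.log (Real.exp a + Real.exp b - 1) - a

lemma one_le_exp_add_exp_sub_one {a b : ℝ} (ha : 0 ≤ a) (hb : 0 ≤ b) :
    1 ≤ Real.exp a + Real.exp b - 1 := by
  have := Real.one_le_exp ha
  have := Real.one_le_exp hb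
  linarith

lemma freeProb_eq_exp (a b : I) : freeProb a b = Real.exp (-offerRate a b) := by
  have h := one_le_exp_add_exp_sub_one a.2.1 b.2.1
  unfold freeProb offerRate
  rw [neg_sub, Real.exp_sub, Real.exp_log (by linarith)]

lemma freeProb_mem_Icc (a b : I) : freeProb a b ∈ Set.Icc (0 : ℝ) 1 := by
  have h := one_le_exp_add_exp_sub_one a.2.1 b.2.1
  have h2 := Real.one_le_exp b.2.1
  unfold freeProb
  refine ⟨div_nonneg (Real.exp_pos _).le (by linarith), ?_⟩
  rw [div_le_one (by linarith)]
  linarith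

lemma measurable_freeProb : Measurable fun p : I × I => freeProb p.1 p.2 := by
  unfold freeProb
  fun_prop

/-- With `freeProb_eq_exp` this is the fixed-point equation for the limit. The arguments swap roles
because an offering vertex with seed `c` must be free up to the seed `a` of the receiver. -/
lemma integral_freeProb (a b : I) :
    ∫ c : I, (if c < b then freeProb c a else 0) = offerRate a b := by
  have hpos : ∀ c ∈ Set.uIcc (0 : ℝ) b, 1 ≤ Real.exp c + Real.exp a - 1 := by
    intro c hc
    rw [Set.uIcc_of_le b.2.1] at hc
    exact one_le_exp_add_exp_sub_one hc.1 a.2.1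
  have h := integral_ite_lt (fun c => Real.exp c / (Real.exp c + Real.exp a - 1)) b
  unfold freeProb offerRate
  rw [h, intervalIntegral.integral_eq_sub_of_hasDerivAt
    (f := fun c => Real.log (Real.exp c + Real.exp a - 1))]
  · rw [add_comm (Real.exp (b : ℝ))]
    simp
  · intro c hc
    have := hpos c hc
    exact (((Real.hasDerivAt_exp c).add_const _).sub_const _).log (by linarith)
  · refine ContinuousOn.intervalIntegrable (ContinuousOn.div (by fun_prop) (by fun_prop) ?_)
    intro c hc
    have := hpos c hc
    linarith

lemma offerRate_mem_Icc (a b : I) : offerRate a b ∈ Set.Icc (0 : ℝ) 1 := by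
  rw [← integral_freeProb]
  have h : ∀ c : I, (if c < b then freeProb c a else 0) ∈ Set.Icc (0 : ℝ) 1 := by
    intro c
    split_ifs
    · exact freeProb_mem_Icc _ _
    · simp
  refine ⟨integral_nonneg fun c => (h c).1, ?_⟩
  have := integral_mono_of_nonneg (μ := (volume : Measure I))
    (Eventually.of_forall fun c => (h c).1) (integrable_const (1 : ℝ))
    (Eventually.of_forall fun c => (h c).2)
  simpa using this

/-- The integrand `exp a * exp b / (exp a + exp b - 1) ^ 2` is the derivative in `b` of `-freeProb a
b`. -/
lemma integral_freeProb_mul (a : I) : ∫ b : I, freeProb a b * freeProb b a =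
    1 - Real.exp a / (Real.exp a + Real.exp 1 - 1) := by
  have hpos : ∀ c ∈ Set.uIcc (0 : ℝ) 1, 1 ≤ Real.exp a + Real.exp c - 1 := by
    intro c hc
    rw [Set.uIcc_of_le zero_le_one] at hc
    exact one_le_exp_add_exp_sub_one a.2.1 hc.1
  have h := integral_unitInterval_eq (fun b => Real.exp a / (Real.exp a + Real.exp b - 1) *
    (Real.exp b / (Real.exp b + Real.exp a - 1)))
  unfold freeProb
  rw [h, intervalIntegral.integral_eq_sub_of_hasDerivAt
    (f := fun c => -(Real.exp a / (Real.exp a + Real.exp c - 1)))]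
  · have := Real.exp_ne_zero (a : ℝ)
    simp [this]
    ring
  · intro c hc
    have := hpos c hc
    have hd := ((((Real.hasDerivAt_exp c).const_add (Real.exp a)).sub_const 1).fun_inv
      (by linarith)).const_mul (Real.exp (a : ℝ))
    refine hd.neg.congr_deriv ?_
    rw [add_comm (Real.exp c)]
    have : Real.exp a + Real.exp c - 1 ≠ 0 := by linarith
    field_simp
  · refine ContinuousOn.intervalIntegrable (ContinuousOn.mul (ContinuousOn.div (by fun_prop)
      (by fun_prop) ?_) (ContinuousOn.div (by fun_prop) (by fun_prop) ?_)) <;>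
    · intro c hc
      have := hpos c hc
      linarith

lemma integral_integral_freeProb_mul : ∫ a : I, ∫ b : I, freeProb a b * freeProb b a =
    1 - Real.log (2 - 1 / Real.exp 1) := by
  simp_rw [integral_freeProb_mul]
  have he := Real.one_lt_exp_iff.2 (zero_lt_one' ℝ)
  have hpos : ∀ c ∈ Set.uIcc (0 : ℝ) 1, 0 < Real.exp c + Real.exp 1 - 1 := by
    intro c _
    have := Real.exp_pos c
    linarith
  rw [integral_unitInterval_eq (fun a => 1 - Real.exp a / (Real.exp a + Real.exp 1 - 1)),
    intervalIntegral.integral_eq_sub_of_hasDerivAt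
      (f := fun c => c - Real.log (Real.exp c + Real.exp 1 - 1))]
  · have h0 : Real.exp 0 + Real.exp 1 - 1 = Real.exp 1 := by simp
    have h1 : 2 - 1 / Real.exp 1 = (Real.exp 1 + Real.exp 1 - 1) / Real.exp 1 := by
      field_simp
      ring
    rw [h0, h1, Real.log_div (by linarith) (by linarith)]
    ring
  · intro c hc
    exact (hasDerivAt_id c).sub
      ((((Real.hasDerivAt_exp c).add_const _).sub_const _).log (hpos c hc).ne')
  · exact ContinuousOn.intervalIntegrable (ContinuousOn.sub (by fun_prop)
      (ContinuousOn.div (by fun_prop) (by fun_prop) fun c hc => (hpos c hc).ne'))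

end Calculus

/-! ### Deleting one vertex, and averaging over the states of the edges at a vertex -/

section Averaging

lemma abs_prod_sub_prod_le {ι : Type*} (s : Finset ι) (f g : ι → ℝ) (hf : ∀ i ∈ s, |f i| ≤ 1)
    (hg : ∀ i ∈ s, |g i| ≤ 1) : |∏ i ∈ s, f i - ∏ i ∈ s, g i| ≤ ∑ i ∈ s, |f i - g i| := by
  classical
  induction s using Finset.induction_on with
  | empty => simp
  | insert a s ha ih =>
    rw [Finset.prod_insert ha, Finset.prod_insert ha, Finset.sum_insert ha]
    have h1 := ih (fun i hi => hf i (by simp [hi])) (fun i hi => hg i (by simp [hi]))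
    have h2 : |∏ i ∈ s, g i| ≤ 1 := by
      rw [Finset.abs_prod]
      exact Finset.prod_le_one (fun _ _ => abs_nonneg _) fun i hi => hg i (by simp [hi])
    calc |f a * ∏ i ∈ s, f i - g a * ∏ i ∈ s, g i|
        = |(f a - g a) * ∏ i ∈ s, g i + f a * (∏ i ∈ s, f i - ∏ i ∈ s, g i)| := by ring_nf
      _ ≤ |f a - g a| * |∏ i ∈ s, g i| + |f a| * |∏ i ∈ s, f i - ∏ i ∈ s, g i| := by
          rw [← abs_mul, ← abs_mul]; exact abs_add_le _ _
      _ ≤ |f a - g a| * 1 + 1 * |∏ i ∈ s, f i - ∏ i ∈ s, g i| := by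
          gcongr
          exact hf a (by simp)
      _ ≤ _ := by linarith

lemma integral_sq_le {β : Type*} [MeasurableSpace β] {μ : Measure β} [IsProbabilityMeasure μ]
    {X : β → ℝ} (hX : Measurable X) {C : ℝ} (hC : ∀ ω, |X ω| ≤ C) :
    (∫ ω, X ω ∂μ) ^ 2 ≤ ∫ ω, X ω ^ 2 ∂μ := by
  set m := ∫ ω, X ω ∂μ
  have hi : Integrable X μ := integrable_of_abs_le hX hC
  have hi2 : Integrable (fun ω => X ω ^ 2) μ := by
    refine integrable_of_abs_le (hX.pow_const 2) (C := C ^ 2) fun ω => ?_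
    rw [abs_pow]
    exact pow_le_pow_left₀ (abs_nonneg _) (hC ω) 2
  have h0 : 0 ≤ ∫ ω, (X ω - m) ^ 2 ∂μ := integral_nonneg fun ω => sq_nonneg _
  have h1 : ∫ ω, (X ω - m) ^ 2 ∂μ = ∫ ω, X ω ^ 2 ∂μ - m ^ 2 := by
    calc _ = ∫ ω, (X ω ^ 2 - 2 * m * X ω + m ^ 2) ∂μ := by
          refine integral_congr_ae (Eventually.of_forall fun ω => ?_)
          dsimp only
          ring
      _ = _ := by
          have hi3 : Integrable (fun ω => X ω ^ 2 - 2 * m * X ω) μ := hi2.sub (hi.const_mul _)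
          rw [integral_add hi3 (integrable_const _), integral_sub hi2 (hi.const_mul _),
            integral_const_mul]
          simp only [integral_const, probReal_univ, smul_eq_mul, one_mul]
          ring
  linarith

variable {V : Type*} [Fintype V] [DecidableEq V] {G : SimpleGraph V} [DecidableRel G.Adj]

lemma edgeFree_freeInd {K : Finset V} {u p : V} {e : Sym2 V} (A B : (V → I) → I) (hp : p ∈ e)
    (hpK : p ∉ insert u K) :
    EdgeFree (G := G) (fun ω => freeInd K u (A ω.1) (B ω.1) ω) e := by
  intro t act act' h
  refine freeInd_congr (fun _ _ => rfl) fun w hw z hz => activeInd_congr fun he => h _ ?_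
  rintro rfl
  rcases Sym2.mem_iff.1 hp with rfl | rfl
  · exact hpK hz
  · exact hpK (by simp [hw])

lemma edgeFree_offerInd {K : Finset V} {w p : V} {e : Sym2 V} (A B : (V → I) → I) (hp : p ∈ e)
    (hw : w ∈ K) (hpK : p ∉ K) :
    EdgeFree (G := G) (fun ω => offerInd K w (A ω.1) (B ω.1) ω) e := by
  intro t act act' h
  have := edgeFree_freeInd (G := G) (K := K.erase w) (u := w) (fun t => t w) A hp
    (by rwa [Finset.insert_erase hw]) t act act' h
  unfold offerInd
  dsimp only at this ⊢
  rw [this]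

lemma seedFree_freeInd {K : Finset V} {u v : V} (a b : I) (hv : v ∉ K) :
    SeedFree (G := G) (freeInd K u a b) v := by
  intro t t' act h
  exact freeInd_congr (fun w hw => h w fun hwv => hv (hwv ▸ hw)) fun _ _ _ _ => rfl

lemma seedFree_offerInd {K : Finset V} {w v : V} (a b : I) (hw : w ∈ K) (hv : v ∉ K) :
    SeedFree (G := G) (offerInd K w a b) v := by
  intro t t' act h
  unfold offerInd
  dsimp only
  have hw' : t w = t' w := h w fun hwv => hv (hwv ▸ hw)
  simp only [hw', seedFree_freeInd (t' w) a (K := K.erase w) (by simp [hv]) t t' act h]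

lemma measurable_seed (w : V) : Measurable fun ω : (V → I) × (G.edgeSet → Bool) => ω.1 w :=
  (measurable_pi_apply w).comp measurable_fst

lemma sum_edgeWeight_le (x : G.edgeSet → I) (hx : ∀ u, ∑ w, edgeWeight x s(u, w) = 1)
    (K : Finset V) (u : V) : ∑ w ∈ K, edgeWeight x s(u, w) ≤ 1 := by
  rw [← hx u]
  exact Finset.sum_le_sum_of_subset_of_nonneg (Finset.subset_univ _)
    fun _ _ _ => edgeWeight_nonneg _ _

lemma integrable_ite_seedWeight (a b : I) :
    Integrable fun c : I => if c < b then seedWeight c a else 0 := by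
  have hWm : Measurable fun c : I => if c < b then seedWeight c a else 0 :=
    Measurable.ite (measurableSet_lt measurable_id measurable_const)
      (measurable_seedWeight.comp (measurable_id.prodMk measurable_const)) measurable_const
  refine integrable_of_abs_le hWm (C := Real.exp 4) fun c => ?_
  split_ifs
  · rw [abs_of_nonneg (zero_le_one.trans (one_le_seedWeight c a))]
    exact seedWeight_le _ _
  · simpa using (Real.exp_pos 4).le

/-- Integrating out the seed of `w` turns a bound for free indicators rooted at `w` into one for its
offer, with half the weight. The bound is a hypothesis so that the lemma serves inside the next
induction as well as after it. -/
lemma integral_abs_offerInd_erase_le_of_freeInd (x : G.edgeSet → I) {ε : ℝ} (hε0 : 0 ≤ ε)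
    (K : Finset V) (w w' : V) (a b : I)
    (h : ∀ c, ∫ ω, |freeInd (K.erase w) w c a ω - freeInd ((K.erase w).erase w') w c a ω| ∂law x ≤
      ε * seedWeight c a) :
    ∫ ω, |offerInd K w a b ω - offerInd (K.erase w') w a b ω| ∂law x ≤
      ε * ((seedWeight a b - 1) / 2) := by
  set Y : I → (V → I) × (G.edgeSet → Bool) → ℝ := fun c ω =>
    if c < b then |freeInd (K.erase w) w c a ω - freeInd ((K.erase w).erase w') w c a ω|
      else 0 with hYdef
  have hYm : Measurable (Function.uncurry Y) := by
    refine Measurable.ite (measurableSet_lt measurable_fst measurable_const) ?_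
      measurable_const
    exact ((measurable_freeInd _ w measurable_fst measurable_const measurable_snd).sub
      (measurable_freeInd _ w measurable_fst measurable_const measurable_snd)).abs
  have hY1 : ∀ c ω, |Y c ω| ≤ 1 := by
    intro c ω
    rw [hYdef]
    dsimp only
    split_ifs
    · have h1 := freeInd_mem_Icc (K.erase w) w c a ω
      have h2 := freeInd_mem_Icc ((K.erase w).erase w') w c a ω
      rw [abs_abs, abs_le]
      exact ⟨by linarith [h1.1, h2.2], by linarith [h1.2, h2.1]⟩
    · simp
  have hYf : ∀ c, SeedFree (Y c) w := by
    intro c t t' act ht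
    rw [hYdef]
    dsimp only
    rw [seedFree_freeInd c a (by simp) t t' act ht,
      seedFree_freeInd c a (by simp) t t' act ht]
  have hDY : ∀ ω, |offerInd K w a b ω - offerInd (K.erase w') w a b ω| = Y (ω.1 w) ω := by
    intro ω
    rw [hYdef]
    dsimp only
    unfold offerInd
    rw [Finset.erase_right_comm]
    split_ifs <;> simp
  simp_rw [hDY]
  rw [integral_seed_swap x w hYm hY1 hYf]
  calc ∫ c, ∫ ω, Y c ω ∂law x
      ≤ ∫ c : I, ε * (if c < b then seedWeight c a else 0) := by
        refine integral_mono_of_nonneg (Eventually.of_forall fun c => integral_nonneg fun ω => ?_)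
          ?_ (Eventually.of_forall fun c => ?_)
        · change 0 ≤ Y c ω
          rw [hYdef]
          dsimp only
          split_ifs
          · exact abs_nonneg _
          · exact le_rfl
        · exact (integrable_ite_seedWeight a b).const_mul _
        · rw [hYdef]
          dsimp only
          split_ifs
          · exact h c
          · simp
    _ = ε * ∫ c : I, (if c < b then seedWeight c a else 0) := integral_const_mul _ _
    _ ≤ _ := mul_le_mul_of_nonneg_left (integral_seedWeight_le a b) hε0

/-- The event that deleting `w'` changes the free indicator has expectation at most of order
`ε`. -/
lemma integral_abs_freeInd_erase_le (x : G.edgeSet → I)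
    (hx : ∀ u, ∑ w, edgeWeight x s(u, w) = 1) {ε : ℝ} (hε : ∀ e, edgeWeight x e ≤ ε)
    (K : Finset V) {u w' : V} (hu : u ∉ K) (hw' : w' ∈ K) (a b : I) :
    ∫ ω, |freeInd K u a b ω - freeInd (K.erase w') u a b ω| ∂law x ≤ ε * seedWeight a b := by
  have hε0 : 0 ≤ ε := (edgeWeight_nonneg x s(u, u)).trans (hε _)
  induction hn : K.card using Nat.strong_induction_on generalizing K u a b with
  | _ n ih =>
    set D : V → (V → I) × (G.edgeSet → Bool) → ℝ :=
      fun w ω => |offerInd K w a b ω - offerInd (K.erase w') w a b ω| with hD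
    have hDm : ∀ w, Measurable (D w) := fun w =>
      ((measurable_offerInd K w measurable_const measurable_const measurable_id).sub
        (measurable_offerInd _ w measurable_const measurable_const measurable_id)).abs
    have hD1 : ∀ w ω, |D w ω| ≤ 1 := by
      intro w ω
      have h1 := offerInd_mem_Icc K w a b ω
      have h2 := offerInd_mem_Icc (K.erase w') w a b ω
      rw [hD, abs_abs, abs_le]
      exact ⟨by linarith [h1.1, h2.2], by linarith [h1.2, h2.1]⟩
    have hbm : ∀ e, Measurable fun ω : (V → I) × (G.edgeSet → Bool) => activeInd ω.2 e :=
      fun e => (measurable_activeInd e).comp measurable_snd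
    have hbD : ∀ w, Integrable (fun ω => activeInd ω.2 s(u, w) * D w ω) (law x) := by
      intro w
      refine integrable_of_abs_le ((hbm _).mul (hDm w)) (C := 1) fun ω => ?_
      rw [abs_mul, abs_of_nonneg (activeInd_nonneg _ _)]
      exact mul_le_one₀ (activeInd_le_one _ _) (abs_nonneg _) (hD1 w ω)
    have hb : Integrable (fun ω : (V → I) × (G.edgeSet → Bool) => activeInd ω.2 s(u, w'))
        (law x) := by
      refine integrable_of_abs_le (hbm _) (C := 1) fun ω => ?_
      rw [abs_of_nonneg (activeInd_nonneg _ _)]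
      exact activeInd_le_one _ _
    have hfac : ∀ (L : Finset V) w (ω : (V → I) × (G.edgeSet → Bool)), 1 - activeInd ω.2 s(u, w) * offerInd L w a b ω ∈
        Set.Icc (0 : ℝ) 1 := by
      intro L w ω
      have := offerInd_mem_Icc L w a b ω
      have h2 := mul_nonneg (activeInd_nonneg ω.2 s(u, w)) this.1
      have h3 := mul_le_one₀ (activeInd_le_one ω.2 s(u, w)) this.1 this.2
      constructor <;> linarith
    -- The root notices the deletion of `w'` only through an active edge to `w'` or through an
    -- active neighbour whose own offer has changed.
    have hpt : ∀ ω, |freeInd K u a b ω - freeInd (K.erase w') u a b ω| ≤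
        activeInd ω.2 s(u, w') + ∑ w ∈ K.erase w', activeInd ω.2 s(u, w) * D w ω := by
      intro ω
      rw [freeInd_eq, freeInd_eq, ← Finset.mul_prod_erase _ _ hw']
      set A := ∏ w ∈ K.erase w', (1 - activeInd ω.2 s(u, w) * offerInd K w a b ω) with hA
      have hA1 : |A| ≤ 1 := by
        rw [hA, Finset.abs_prod]
        refine Finset.prod_le_one (fun _ _ => abs_nonneg _) fun w _ => ?_
        rw [abs_of_nonneg (hfac K w ω).1]
        exact (hfac K w ω).2
      have hsum := abs_prod_sub_prod_le (K.erase w')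
        (fun w => 1 - activeInd ω.2 s(u, w) * offerInd K w a b ω)
        (fun w => 1 - activeInd ω.2 s(u, w) * offerInd (K.erase w') w a b ω)
        (fun w _ => by rw [abs_of_nonneg (hfac K w ω).1]; exact (hfac K w ω).2)
        (fun w _ => by rw [abs_of_nonneg (hfac _ w ω).1]; exact (hfac _ w ω).2)
      have hterm : ∀ w ∈ K.erase w', |1 - activeInd ω.2 s(u, w) * offerInd K w a b ω -
          (1 - activeInd ω.2 s(u, w) * offerInd (K.erase w') w a b ω)| =
          activeInd ω.2 s(u, w) * D w ω := by
        intro w _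
        rw [hD]
        dsimp only
        rw [← abs_of_nonneg (activeInd_nonneg ω.2 s(u, w)), ← abs_mul,
          abs_of_nonneg (activeInd_nonneg ω.2 s(u, w)), ← abs_neg]
        congr 1
        ring
      rw [Finset.sum_congr rfl hterm] at hsum
      set B := ∏ w ∈ K.erase w', (1 - activeInd ω.2 s(u, w) * offerInd (K.erase w') w a b ω)
      have hq := offerInd_mem_Icc K w' a b ω
      have hbq : activeInd ω.2 s(u, w') * offerInd K w' a b ω ≤ activeInd ω.2 s(u, w') :=
        mul_le_of_le_one_right (activeInd_nonneg _ _) hq.2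
      have hbq0 := mul_nonneg (activeInd_nonneg ω.2 s(u, w')) hq.1
      set y := activeInd ω.2 s(u, w') * offerInd K w' a b ω
      calc |(1 - y) * A - B| = |(A - B) + -(y * A)| := by ring_nf
        _ ≤ |A - B| + |-(y * A)| := abs_add_le _ _
        _ = |A - B| + y * |A| := by rw [abs_neg, abs_mul, abs_of_nonneg hbq0]
        _ ≤ |A - B| + y * 1 := by gcongr
        _ ≤ _ := by linarith
    have hDint : ∀ w ∈ K.erase w', ∫ ω, D w ω ∂law x ≤ ε * ((seedWeight a b - 1) / 2) := by
      intro w hw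
      refine integral_abs_offerInd_erase_le_of_freeInd x hε0 K w w' a b fun c => ?_
      exact ih _ (hn ▸ Finset.card_erase_lt_of_mem (Finset.mem_of_mem_erase hw)) (K.erase w)
        (by simp) (by simp [(Finset.ne_of_mem_erase hw).symm, hw']) _ _ rfl
    have hW := one_le_seedWeight a b
    calc ∫ ω, |freeInd K u a b ω - freeInd (K.erase w') u a b ω| ∂law x
        ≤ ∫ ω, (activeInd ω.2 s(u, w') +
            ∑ w ∈ K.erase w', activeInd ω.2 s(u, w) * D w ω) ∂law x :=
          integral_mono_of_nonneg (Eventually.of_forall fun ω => abs_nonneg _)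
            (hb.add (integrable_finsetSum _ fun w _ => hbD w)) (Eventually.of_forall hpt)
      _ = edgeWeight x s(u, w') +
            ∑ w ∈ K.erase w', edgeWeight x s(u, w) * ∫ ω, D w ω ∂law x := by
          rw [integral_add hb (integrable_finsetSum _ fun w _ => hbD w),
            integral_finsetSum _ fun w _ => hbD w]
          congr 1
          · have := integral_activeInd_mul x s(u, w') (X := fun _ => 1) measurable_const
              (C := 1) (by simp) (fun _ _ _ _ => rfl)
            simpa using this
          · refine Finset.sum_congr rfl fun w hw => ?_
            refine integral_activeInd_mul x _ (hDm w) (hD1 w) ?_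
            intro t act act' h
            have hwK := Finset.mem_of_mem_erase hw
            have h1 := edgeFree_offerInd (G := G) (K := K) (fun _ => a) (fun _ => b)
              (Sym2.mem_mk_left u w) hwK hu t act act' h
            have h2 := edgeFree_offerInd (G := G) (K := K.erase w') (fun _ => a) (fun _ => b)
              (Sym2.mem_mk_left u w) hw (by simp [hu]) t act act' h
            dsimp only at h1 h2
            rw [hD]
            dsimp only
            rw [h1, h2]
      _ ≤ ε + ∑ w ∈ K.erase w', edgeWeight x s(u, w) * (ε * ((seedWeight a b - 1) / 2)) := by
          refine add_le_add (hε _) (Finset.sum_le_sum fun w hw => ?_)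
          exact mul_le_mul_of_nonneg_left (hDint w hw) (edgeWeight_nonneg _ _)
      _ ≤ ε + 1 * (ε * ((seedWeight a b - 1) / 2)) := by
          rw [← Finset.sum_mul]
          gcongr
          exact sum_edgeWeight_le x hx _ _
      -- The bound reproduces itself, since `1 + (W - 1) / 2 ≤ W` for a weight `W ≥ 1`.
      _ ≤ ε * seedWeight a b := by nlinarith

/-- The free indicator averaged over the states of the edges at `u`. -/
def meanFree (x : G.edgeSet → I) (K : Finset V) (u : V) (a b : I)
    (ω : (V → I) × (G.edgeSet → Bool)) : ℝ :=
  ∏ w ∈ K, (1 - edgeWeight x s(u, w) * offerInd K w a b ω)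

/-- The expected number of offers to `u`, given the graph induced by `K`. -/
def offerMass (x : G.edgeSet → I) (K : Finset V) (u : V) (a b : I)
    (ω : (V → I) × (G.edgeSet → Bool)) : ℝ :=
  ∑ w ∈ K, edgeWeight x s(u, w) * offerInd K w a b ω

lemma edgeWeight_mul_offerInd_mem_Icc (x : G.edgeSet → I) (K : Finset V) (u w : V) (a b : I)
    (ω : (V → I) × (G.edgeSet → Bool)) :
    edgeWeight x s(u, w) * offerInd K w a b ω ∈ Set.Icc (0 : ℝ) 1 := by
  have h := offerInd_mem_Icc K w a b ω
  exact ⟨mul_nonneg (edgeWeight_nonneg _ _) h.1, mul_le_one₀ (edgeWeight_le_one _ _) h.1 h.2⟩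

lemma meanFree_mem_Icc (x : G.edgeSet → I) (K : Finset V) (u : V) (a b : I)
    (ω : (V → I) × (G.edgeSet → Bool)) : meanFree x K u a b ω ∈ Set.Icc (0 : ℝ) 1 := by
  have h := fun w => edgeWeight_mul_offerInd_mem_Icc x K u w a b ω
  exact ⟨Finset.prod_nonneg fun w _ => by linarith [(h w).2],
    Finset.prod_le_one (fun w _ => by linarith [(h w).2]) fun w _ => by linarith [(h w).1]⟩

lemma offerMass_nonneg (x : G.edgeSet → I) (K : Finset V) (u : V) (a b : I)
    (ω : (V → I) × (G.edgeSet → Bool)) : 0 ≤ offerMass x K u a b ω :=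
  Finset.sum_nonneg fun w _ => (edgeWeight_mul_offerInd_mem_Icc x K u w a b ω).1

lemma offerMass_le_one (x : G.edgeSet → I) (hx : ∀ u, ∑ w, edgeWeight x s(u, w) = 1)
    (K : Finset V) (u : V) (a b : I) (ω : (V → I) × (G.edgeSet → Bool)) :
    offerMass x K u a b ω ≤ 1 :=
  (Finset.sum_le_sum fun w _ => mul_le_of_le_one_right (edgeWeight_nonneg _ _)
    (offerInd_mem_Icc K w a b ω).2).trans (sum_edgeWeight_le x hx K u)

lemma measurable_meanFree {β : Type*} [MeasurableSpace β] (x : G.edgeSet → I) (K : Finset V)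
    (u : V) {a b : β → I} {ω : β → (V → I) × (G.edgeSet → Bool)} (ha : Measurable a)
    (hb : Measurable b) (hω : Measurable ω) :
    Measurable fun p => meanFree x K u (a p) (b p) (ω p) :=
  Finset.measurable_prod _ fun w _ =>
    measurable_const.sub (measurable_const.mul (measurable_offerInd K w ha hb hω))

lemma measurable_offerMass {β : Type*} [MeasurableSpace β] (x : G.edgeSet → I) (K : Finset V)
    (u : V) {a b : β → I} {ω : β → (V → I) × (G.edgeSet → Bool)} (ha : Measurable a)
    (hb : Measurable b) (hω : Measurable ω) :
    Measurable fun p => offerMass x K u (a p) (b p) (ω p) :=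
  Finset.measurable_sum _ fun w _ => measurable_const.mul (measurable_offerInd K w ha hb hω)

lemma edgeFree_meanFree (x : G.edgeSet → I) {K : Finset V} {u p : V} {e : Sym2 V}
    (A B : (V → I) → I) (hp : p ∈ e) (hpK : p ∉ K) :
    EdgeFree (fun ω => meanFree x K u (A ω.1) (B ω.1) ω) e := by
  intro t act act' h
  refine Finset.prod_congr rfl fun w hw => ?_
  have := edgeFree_offerInd (G := G) A B hp hw hpK t act act' h
  dsimp only at this ⊢
  rw [this]

lemma seedFree_meanFree (x : G.edgeSet → I) {K : Finset V} {u v : V} (a b : I) (hv : v ∉ K) :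
    SeedFree (meanFree x K u a b) v := by
  intro t t' act h
  refine Finset.prod_congr rfl fun w hw => ?_
  rw [seedFree_offerInd a b hw hv t t' act h]

lemma integral_freeInd_mul (x : G.edgeSet → I) {L : Finset V} {u : V} (hu : u ∉ L)
    {A B : (V → I) → I} (hA : Measurable A) (hB : Measurable B)
    {X : (V → I) × (G.edgeSet → Bool) → ℝ} (hX : Measurable X) (hX1 : ∀ ω, |X ω| ≤ 1)
    (hXf : ∀ z ∈ L, EdgeFree X s(u, z)) :
    ∫ ω, freeInd L u (A ω.1) (B ω.1) ω * X ω ∂law x =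
      ∫ ω, meanFree x L u (A ω.1) (B ω.1) ω * X ω ∂law x := by
  simp_rw [freeInd_eq, meanFree]
  exact integral_prod_activeInd x (Q := fun z ω => offerInd L z (A ω.1) (B ω.1) ω)
    (fun z => measurable_offerInd L z (hA.comp measurable_fst) (hB.comp measurable_fst)
      measurable_id) (fun z ω => offerInd_mem_Icc _ _ _ _ _)
    (fun z _ y hy => edgeFree_offerInd A B (Sym2.mem_mk_left u z) hy hu) hX hX1 hXf

/-- Each factor satisfies `|1 - y - exp (-y)| ≤ y ^ 2 ≤ x_{uw} * ε`, and the weights at `u` sum to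
at most one. -/
lemma abs_meanFree_sub_exp_le (x : G.edgeSet → I) (hx : ∀ u, ∑ w, edgeWeight x s(u, w) = 1)
    {ε : ℝ} (hε : ∀ e, edgeWeight x e ≤ ε) (K : Finset V) (u : V) (a b : I)
    (ω : (V → I) × (G.edgeSet → Bool)) :
    |meanFree x K u a b ω - Real.exp (-offerMass x K u a b ω)| ≤ ε := by
  have hε0 : 0 ≤ ε := (edgeWeight_nonneg x s(u, u)).trans (hε _)
  have h := fun w => edgeWeight_mul_offerInd_mem_Icc x K u w a b ω
  unfold meanFree offerMass
  rw [← Finset.sum_neg_distrib, Real.exp_sum]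
  refine (abs_prod_sub_prod_le _ _ _ (fun w _ => ?_) (fun w _ => ?_)).trans ?_
  · rw [abs_le]
    constructor <;> linarith [(h w).1, (h w).2]
  · rw [Real.abs_exp, Real.exp_le_one_iff]
    linarith [(h w).1]
  calc _ ≤ ∑ w ∈ K, edgeWeight x s(u, w) * ε := by
        refine Finset.sum_le_sum fun w _ => ?_
        have h1 := Real.abs_exp_sub_one_sub_id_le
          (x := -(edgeWeight x s(u, w) * offerInd K w a b ω))
          (by rw [abs_neg, abs_of_nonneg (h w).1]; exact (h w).2)
        have h2 : edgeWeight x s(u, w) * offerInd K w a b ω ≤ edgeWeight x s(u, w) :=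
          mul_le_of_le_one_right (edgeWeight_nonneg _ _) (offerInd_mem_Icc K w a b ω).2
        rw [abs_sub_comm]
        calc _ ≤ (-(edgeWeight x s(u, w) * offerInd K w a b ω)) ^ 2 := by
              convert h1 using 2
              ring
          _ = (edgeWeight x s(u, w) * offerInd K w a b ω) *
              (edgeWeight x s(u, w) * offerInd K w a b ω) := by ring
          _ ≤ _ := mul_le_mul h2 (h2.trans (hε _)) (h w).1 (edgeWeight_nonneg _ _)
    _ ≤ 1 * ε := by
        rw [← Finset.sum_mul]
        gcongr
        exact sum_edgeWeight_le x hx _ _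
    _ = ε := one_mul _

end Averaging

/-! ### Concentration of the number of offers -/

section Concentration

variable {V : Type*} [Fintype V] [DecidableEq V] {G : SimpleGraph V} [DecidableRel G.Adj]

/-- The deviation of the conditional probability of an offer by `u` from its limit. -/
def offerDev (x : G.edgeSet → I) (L : Finset V) (u : V) (a b : I)
    (ω : (V → I) × (G.edgeSet → Bool)) : ℝ :=
  ∫ c : I, (if c < b then meanFree x L u c a ω - freeProb c a else 0)

lemma abs_ite_meanFree_sub_le_one (x : G.edgeSet → I) (L : Finset V) (u : V) (a b c : I)
    (ω : (V → I) × (G.edgeSet → Bool)) :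
    |if c < b then meanFree x L u c a ω - freeProb c a else 0| ≤ 1 := by
  split_ifs
  · have h1 := meanFree_mem_Icc x L u c a ω
    have h2 := freeProb_mem_Icc c a
    rw [abs_le]
    constructor <;> linarith [h1.1, h1.2, h2.1, h2.2]
  · simp

lemma measurable_ite_meanFree_sub (x : G.edgeSet → I) (L : Finset V) (u : V) (a b : I) :
    Measurable fun p : I × ((V → I) × (G.edgeSet → Bool)) =>
      if p.1 < b then meanFree x L u p.1 a p.2 - freeProb p.1 a else 0 :=
  Measurable.ite (measurableSet_lt measurable_fst measurable_const)
    ((measurable_meanFree x L u measurable_fst measurable_const measurable_snd).sub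
      (measurable_freeProb.comp (measurable_fst.prodMk measurable_const))) measurable_const

lemma measurable_offerDev (x : G.edgeSet → I) (L : Finset V) (u : V) (a b : I) :
    Measurable (offerDev x L u a b) :=
  (measurable_ite_meanFree_sub x L u a b).stronglyMeasurable.integral_prod_left.measurable

lemma abs_offerDev_le_one (x : G.edgeSet → I) (L : Finset V) (u : V) (a b : I)
    (ω : (V → I) × (G.edgeSet → Bool)) : |offerDev x L u a b ω| ≤ 1 := by
  have := norm_integral_le_of_norm_le_const (μ := (volume : Measure I))
    (f := fun c => if c < b then meanFree x L u c a ω - freeProb c a else 0) (C := 1)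
    (Eventually.of_forall fun c => abs_ite_meanFree_sub_le_one x L u a b c ω)
  simpa [offerDev] using this

lemma edgeFree_offerDev (x : G.edgeSet → I) {L : Finset V} {u p : V} {e : Sym2 V} (a b : I)
    (hp : p ∈ e) (hpL : p ∉ L) : EdgeFree (offerDev x L u a b) e := by
  intro t act act' h
  unfold offerDev
  congr 1
  ext c
  have := edgeFree_meanFree x (u := u) (fun _ => c) (fun _ => a) hp hpL t act act' h
  dsimp only at this
  rw [this]

lemma seedFree_offerDev (x : G.edgeSet → I) {L : Finset V} {u v : V} (a b : I) (hv : v ∉ L) :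
    SeedFree (offerDev x L u a b) v := by
  intro t t' act h
  unfold offerDev
  congr 1
  ext c
  rw [seedFree_meanFree x c a hv t t' act h]

lemma offerDev_eq (x : G.edgeSet → I) (L : Finset V) (u : V) (a b : I)
    (ω : (V → I) × (G.edgeSet → Bool)) :
    offerDev x L u a b ω =
      ∫ c : I, ((if c < b then meanFree x L u c a ω else 0) - offerRate a b) := by
  have hm : Measurable fun c : I => if c < b then meanFree x L u c a ω else 0 :=
    Measurable.ite (measurableSet_lt measurable_id measurable_const)
      (measurable_meanFree x L u measurable_id measurable_const measurable_const) measurable_const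
  have hm2 : Measurable fun c : I => if c < b then freeProb c a else 0 :=
    Measurable.ite (measurableSet_lt measurable_id measurable_const)
      (measurable_freeProb.comp (measurable_id.prodMk measurable_const)) measurable_const
  have hi : Integrable fun c : I => if c < b then meanFree x L u c a ω else 0 := by
    refine integrable_of_abs_le hm (C := 1) fun c => ?_
    split_ifs
    · rw [abs_of_nonneg (meanFree_mem_Icc x L u c a ω).1]
      exact (meanFree_mem_Icc x L u c a ω).2
    · simp
  have hi2 : Integrable fun c : I => if c < b then freeProb c a else 0 := by
    refine integrable_of_abs_le hm2 (C := 1) fun c => ?_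
    split_ifs
    · rw [abs_of_nonneg (freeProb_mem_Icc c a).1]
      exact (freeProb_mem_Icc c a).2
    · simp
  rw [integral_sub hi (integrable_const _)]
  simp only [integral_const, probReal_univ, smul_eq_mul, one_mul]
  rw [← integral_freeProb, ← integral_sub hi hi2]
  unfold offerDev
  congr 1
  ext c
  split_ifs <;> simp

/-- Averaging over the edges from `u` to `L` and then over the seed of `u` replaces the centred
offer by its conditional mean given the graph on `L`, against any test factor that ignores both. -/
lemma integral_offer_sub_mul (x : G.edgeSet → I) {L : Finset V} {u : V} (hu : u ∉ L) (a b : I)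
    {X : (V → I) × (G.edgeSet → Bool) → ℝ} (hX : Measurable X) (hX1 : ∀ ω, |X ω| ≤ 1)
    (hXf : ∀ z ∈ L, EdgeFree X s(u, z)) (hXs : SeedFree X u) :
    ∫ ω, ((if ω.1 u < b then freeInd L u (ω.1 u) a ω else 0) - offerRate a b) * X ω ∂law x =
      ∫ ω, offerDev x L u a b ω * X ω ∂law x := by
  have hlt : MeasurableSet {ω : (V → I) × (G.edgeSet → Bool) | ω.1 u < b} :=
    measurableSet_lt (measurable_seed u) measurable_const
  -- The seed constraint is moved into the test factor; it involves no edge state, so the edge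
  -- states can be averaged before the seed.
  set X₁ : (V → I) × (G.edgeSet → Bool) → ℝ := fun ω => if ω.1 u < b then X ω else 0 with hX₁
  have hX₁m : Measurable X₁ := Measurable.ite hlt hX measurable_const
  have hX₁1 : ∀ ω, |X₁ ω| ≤ 1 := by
    intro ω
    rw [hX₁]
    dsimp only
    split_ifs
    · exact hX1 ω
    · simp
  have hX₁f : ∀ z ∈ L, EdgeFree X₁ s(u, z) := by
    intro z hz t act act' h
    rw [hX₁]
    dsimp only
    rw [hXf z hz t act act' h]
  have hfm : Measurable fun ω : (V → I) × (G.edgeSet → Bool) => freeInd L u (ω.1 u) a ω :=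
    measurable_freeInd L u (measurable_seed u) measurable_const measurable_id
  have hmm : Measurable fun ω : (V → I) × (G.edgeSet → Bool) => meanFree x L u (ω.1 u) a ω :=
    measurable_meanFree x L u (measurable_seed u) measurable_const measurable_id
  have hfi : Integrable (fun ω => freeInd L u (ω.1 u) a ω * X₁ ω) (law x) := by
    refine integrable_of_abs_le (hfm.mul hX₁m) (C := 1) fun ω => ?_
    have := freeInd_mem_Icc L u (ω.1 u) a ω
    rw [abs_mul, abs_of_nonneg this.1]
    exact mul_le_one₀ this.2 (abs_nonneg _) (hX₁1 ω)
  have hmi : Integrable (fun ω => meanFree x L u (ω.1 u) a ω * X₁ ω) (law x) := by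
    refine integrable_of_abs_le (hmm.mul hX₁m) (C := 1) fun ω => ?_
    have := meanFree_mem_Icc x L u (ω.1 u) a ω
    rw [abs_mul, abs_of_nonneg this.1]
    exact mul_le_one₀ this.2 (abs_nonneg _) (hX₁1 ω)
  have hXi : Integrable (fun ω => offerRate a b * X ω) (law x) :=
    (integrable_of_abs_le hX hX1).const_mul _
  have hA : Measurable fun t : V → I => t u := measurable_pi_apply u
  have hB : Measurable fun _ : V → I => a := measurable_const
  set Y : I → (V → I) × (G.edgeSet → Bool) → ℝ := fun c ω =>
    ((if c < b then meanFree x L u c a ω else 0) - offerRate a b) * X ω with hY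
  have hYm : Measurable (Function.uncurry Y) :=
    ((Measurable.ite (measurableSet_lt measurable_fst measurable_const)
      (measurable_meanFree x L u measurable_fst measurable_const measurable_snd)
      measurable_const).sub measurable_const).mul (hX.comp measurable_snd)
  have hY1 : ∀ c ω, |Y c ω| ≤ 1 := by
    intro c ω
    rw [hY]
    dsimp only
    rw [abs_mul]
    refine mul_le_one₀ ?_ (abs_nonneg _) (hX1 ω)
    have h1 := meanFree_mem_Icc x L u c a ω
    have h2 := offerRate_mem_Icc a b
    rw [abs_le]
    split_ifs <;> constructor <;> linarith [h1.1, h1.2, h2.1, h2.2]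
  have hYf : ∀ c, SeedFree (Y c) u := by
    intro c t t' act h
    rw [hY]
    dsimp only
    rw [seedFree_meanFree x c a hu t t' act h, hXs t t' act h]
  calc _ = ∫ ω, (freeInd L u (ω.1 u) a ω * X₁ ω - offerRate a b * X ω) ∂law x := by
        refine integral_congr_ae (Eventually.of_forall fun ω => ?_)
        rw [hX₁]
        dsimp only
        split_ifs <;> ring
    _ = ∫ ω, (meanFree x L u (ω.1 u) a ω * X₁ ω - offerRate a b * X ω) ∂law x := by
        rw [integral_sub hfi hXi, integral_sub hmi hXi]
        congr 1
        exact integral_freeInd_mul x hu hA hB hX₁m hX₁1 hX₁f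
    _ = ∫ ω, Y (ω.1 u) ω ∂law x := by
        refine integral_congr_ae (Eventually.of_forall fun ω => ?_)
        rw [hX₁, hY]
        dsimp only
        split_ifs <;> ring
    _ = _ := by
        rw [integral_seed x u hYm hY1 hYf]
        refine integral_congr_ae (Eventually.of_forall fun ω => ?_)
        rw [hY]
        dsimp only
        rw [integral_mul_const, offerDev_eq]

lemma integral_offerDev_sq_le (x : G.edgeSet → I) (L : Finset V) (u : V) (a b : I) :
    ∫ ω, offerDev x L u a b ω ^ 2 ∂law x ≤
      ∫ c : I, (if c < b then ∫ ω, (meanFree x L u c a ω - freeProb c a) ^ 2 ∂law x else 0) := by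
  have hm := measurable_ite_meanFree_sub x L u a b
  have hsq : ∀ ω, offerDev x L u a b ω ^ 2 ≤
      ∫ c : I, (if c < b then meanFree x L u c a ω - freeProb c a else 0) ^ 2 := fun ω =>
    integral_sq_le (X := fun c : I => if c < b then meanFree x L u c a ω - freeProb c a else 0)
      (hm.comp (measurable_id.prodMk (measurable_const (a := ω))))
      (fun c => abs_ite_meanFree_sub_le_one x L u a b c ω)
  have hi : Integrable (fun p : I × ((V → I) × (G.edgeSet → Bool)) =>
      (if p.1 < b then meanFree x L u p.1 a p.2 - freeProb p.1 a else 0) ^ 2)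
      (volume.prod (law x)) := by
    refine integrable_of_abs_le (hm.pow_const 2) (C := 1) fun p => ?_
    rw [abs_pow]
    exact pow_le_one₀ (abs_nonneg _) (abs_ite_meanFree_sub_le_one x L u a b p.1 p.2)
  calc _ ≤ ∫ ω, (∫ c : I, (if c < b then meanFree x L u c a ω - freeProb c a else 0) ^ 2) ∂law x :=
        integral_mono_of_nonneg (Eventually.of_forall fun ω => sq_nonneg _)
          hi.integral_prod_right (Eventually.of_forall hsq)
    _ = ∫ c : I, ∫ ω, (if c < b then meanFree x L u c a ω - freeProb c a else 0) ^ 2 ∂law x :=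
        (integral_integral_swap hi).symm
    _ = _ := by
        congr 1
        ext c
        split_ifs <;> simp

/-- Compare both with `E = exp (-offerMass)`. The first difference is at most `ε`; the second is at
most the deviation of the offer mass, because `exp (-y)` is 1-Lipschitz on `y ≥ 0`. The square of
the first and the cross term cost `ε + 2 * ε`. -/
lemma integral_meanFree_sub_sq_le (x : G.edgeSet → I)
    (hx : ∀ u, ∑ w, edgeWeight x s(u, w) = 1) {ε : ℝ} (hε : ∀ e, edgeWeight x e ≤ ε)
    (hε1 : ε ≤ 1) (L : Finset V) (u : V) (a b : I) :
    ∫ ω, (meanFree x L u a b ω - freeProb a b) ^ 2 ∂law x ≤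
      ∫ ω, (offerMass x L u a b ω - offerRate a b) ^ 2 ∂law x + 3 * ε := by
  have hε0 : 0 ≤ ε := (edgeWeight_nonneg x s(u, u)).trans (hε _)
  have hm := measurable_offerMass x L u (measurable_const (a := a)) (measurable_const (a := b))
    (measurable_id (α := (V → I) × (G.edgeSet → Bool)))
  have hi : Integrable (fun ω => (offerMass x L u a b ω - offerRate a b) ^ 2) (law x) := by
    refine integrable_of_abs_le ((hm.sub measurable_const).pow_const 2) (C := 1) fun ω => ?_
    rw [abs_pow]
    refine pow_le_one₀ (abs_nonneg _) ?_
    have h1 := offerMass_nonneg x L u a b ω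
    have h2 := offerMass_le_one x hx L u a b ω
    have h3 := offerRate_mem_Icc a b
    rw [abs_le]
    constructor <;> linarith [h3.1, h3.2]
  have hpt : ∀ ω, (meanFree x L u a b ω - freeProb a b) ^ 2 ≤
      (offerMass x L u a b ω - offerRate a b) ^ 2 + 3 * ε := by
    intro ω
    have h1 := abs_le.1 (abs_meanFree_sub_exp_le x hx hε L u a b ω)
    have h2 := abs_exp_neg_sub_exp_neg_le (offerMass_nonneg x L u a b ω) (offerRate_mem_Icc a b).1
    rw [← freeProb_eq_exp] at h2
    have h3 := sq_le_sq' (abs_le.1 h2).1 (abs_le.1 h2).2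
    rw [sq_abs] at h3
    have h4 := freeProb_mem_Icc a b
    have h5 := Real.exp_pos (-offerMass x L u a b ω)
    have h6 : Real.exp (-offerMass x L u a b ω) ≤ 1 := by
      rw [Real.exp_le_one_iff]
      linarith [offerMass_nonneg x L u a b ω]
    set E := Real.exp (-offerMass x L u a b ω)
    set P := meanFree x L u a b ω
    set F := freeProb a b
    have h7 : |(P - E) * (E - F)| ≤ ε * 1 := by
      rw [abs_mul]
      exact mul_le_mul (abs_le.2 h1) (abs_le.2 ⟨by linarith [h4.2], by linarith [h4.1]⟩)
        (abs_nonneg _) hε0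
    have h8 : (P - E) ^ 2 ≤ ε * 1 := by
      rw [← sq_abs, sq]
      exact mul_le_mul (abs_le.2 h1) ((abs_le.2 h1).trans hε1) (abs_nonneg _) hε0
    have h9 := (abs_le.1 h7).2
    nlinarith
  calc _ ≤ ∫ ω, ((offerMass x L u a b ω - offerRate a b) ^ 2 + 3 * ε) ∂law x :=
        integral_mono_of_nonneg (Eventually.of_forall fun ω => sq_nonneg _)
          (hi.add (integrable_const _)) (Eventually.of_forall hpt)
    _ = _ := by
        rw [integral_add hi (integrable_const _)]
        simp
where
  abs_exp_neg_sub_exp_neg_le {y z : ℝ} (hy : 0 ≤ y) (hz : 0 ≤ z) :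
      |Real.exp (-y) - Real.exp (-z)| ≤ |y - z| := by
    have key : ∀ {y z : ℝ}, 0 ≤ y → y ≤ z → |Real.exp (-y) - Real.exp (-z)| ≤ |y - z| := by
      intro y z hy hyz
      have h1 : Real.exp (-z) ≤ Real.exp (-y) := Real.exp_le_exp.2 (by linarith)
      have h2 : Real.exp (-y) ≤ 1 := Real.exp_le_one_iff.2 (by linarith)
      have h3 : Real.exp (-z) = Real.exp (-y) * Real.exp (-(z - y)) := by
        rw [← Real.exp_add]
        ring_nf
      have h4 := Real.add_one_le_exp (-(z - y))
      rw [abs_of_nonneg (by linarith), abs_sub_comm, abs_of_nonneg (by linarith)]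
      nlinarith [Real.exp_pos (-y)]
    rcases le_total y z with h | h
    · exact key hy h
    · rw [abs_sub_comm, abs_sub_comm y]
      exact key hz h

/-- The number of offers to `u`, given the graph induced by `K`, is concentrated around its
limit. -/
lemma integral_offerMass_sub_sq_le (x : G.edgeSet → I)
    (hx : ∀ u, ∑ w, edgeWeight x s(u, w) = 1) {ε : ℝ} (hε : ∀ e, edgeWeight x e ≤ ε)
    (hε1 : ε ≤ 1) (K : Finset V) {u : V} (hu : u ∉ K) (a b : I) :
    ∫ ω, (offerMass x K u a b ω - offerRate a b) ^ 2 ∂law x ≤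
      6 * ε * ((Kᶜ.card : ℝ) + 4) * seedWeight a b := by
  have hε0 : 0 ≤ ε := (edgeWeight_nonneg x s(u, u)).trans (hε _)
  induction hn : K.card using Nat.strong_induction_on generalizing K u a b with
  | _ n ih =>
  set r := offerRate a b with hr
  have hr01 : 0 ≤ r ∧ r ≤ 1 := offerRate_mem_Icc a b
  have hW := one_le_seedWeight a b
  set W := seedWeight a b with hWdef
  set N : ℝ := (Kᶜ.card : ℝ) with hN
  have hN0 : 0 ≤ N := Nat.cast_nonneg _
  set Y : Finset V → V → (V → I) × (G.edgeSet → Bool) → ℝ :=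
    fun L w ω => offerInd L w a b ω - r with hY
  have hYm : ∀ L w, Measurable (Y L w) := fun L w =>
    (measurable_offerInd L w measurable_const measurable_const measurable_id).sub measurable_const
  have hY1 : ∀ L w ω, |Y L w ω| ≤ 1 := by
    intro L w ω
    have h := offerInd_mem_Icc L w a b ω
    rw [abs_le]
    constructor <;> simp only [hY] <;> linarith [h.1, h.2]
  have hYYm : ∀ w w', Measurable fun ω => Y K w ω * Y K w' ω := fun w w' => (hYm K w).mul (hYm K w')
  have hYY1 : ∀ w w' ω, |Y K w ω * Y K w' ω| ≤ 1 := by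
    intro w w' ω
    rw [abs_mul]
    exact mul_le_one₀ (hY1 _ _ _) (abs_nonneg _) (hY1 _ _ _)
  -- off-diagonal terms
  set T : ℝ := ε * W + 3 * ε + 3 * ε * (N + 6) * W with hT
  have hT0 : 0 ≤ T := by positivity
  have hoff : ∀ w ∈ K, ∀ w' ∈ K, w ≠ w' → ∫ ω, Y K w ω * Y K w' ω ∂law x ≤ T := by
    intro w hw w' hw' hne
    set L := (K.erase w).erase w' with hL
    have hwL : w ∉ L := by simp [hL]
    have hw'L : w' ∉ L := by simp [hL]
    have hdel : ∀ v v', v ∈ K → v' ∈ K → v ≠ v' →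
        ∫ ω, |Y K v ω - Y (K.erase v') v ω| ∂law x ≤ ε * ((W - 1) / 2) := by
      intro v v' hv hv' hvv'
      have := integral_abs_offerInd_erase_le_of_freeInd x hε0 K v v' a b fun c =>
        integral_abs_freeInd_erase_le x hx hε (K.erase v) (by simp) (by simp [hvv'.symm, hv']) c a
      simpa [hY] using this
    -- The inductive hypothesis is used on `L`, whose complement has two more vertices, so `N + 4`
    -- becomes `N + 6`; the seed integration halves the constant `6`.
    have hdev : ∀ v, v ∉ L → ∫ ω, offerDev x L v a b ω ^ 2 ∂law x ≤
        3 * ε + 3 * ε * (N + 6) * W := by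
      intro v hv
      refine (integral_offerDev_sq_le x L v a b).trans ?_
      have hcardL : L.card < n := by
        have h1 := Finset.card_erase_lt_of_mem hw
        have h2 := Finset.card_erase_le (s := K.erase w) (a := w')
        rw [← hL] at h2
        omega
      have hcard : ((Lᶜ.card : ℕ) : ℝ) = N + 2 := by
        have h1 : L.card + 2 = K.card := by
          have h2 := Finset.card_erase_add_one hw
          have h3 := Finset.card_erase_add_one (s := K.erase w) (a := w')
            (by simp [hne.symm, hw'])
          rw [← hL] at h3
          omega
        have h2 := Finset.card_compl_add_card L
        have h3 := Finset.card_compl_add_card K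
        have : Lᶜ.card = Kᶜ.card + 2 := by omega
        rw [this]
        push_cast
        rfl
      have hstep : ∀ c, ∫ ω, (meanFree x L v c a ω - freeProb c a) ^ 2 ∂law x ≤
          3 * ε + 6 * ε * (N + 6) * seedWeight c a := by
        intro c
        have h1 := integral_meanFree_sub_sq_le x hx hε hε1 L v c a
        have h2 := ih _ hcardL L hv c a rfl
        rw [hcard] at h2
        linarith
      have hiw := integrable_ite_seedWeight a b
      calc ∫ c : I, (if c < b then
              ∫ ω, (meanFree x L v c a ω - freeProb c a) ^ 2 ∂law x else 0)
          ≤ ∫ c : I, (3 * ε + 6 * ε * (N + 6) * (if c < b then seedWeight c a else 0)) := by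
            refine integral_mono_of_nonneg (Eventually.of_forall fun c => ?_)
              ((integrable_const _).add (hiw.const_mul _)) (Eventually.of_forall fun c => ?_)
            · dsimp only
              split_ifs
              · exact integral_nonneg fun ω => sq_nonneg _
              · exact le_rfl
            · dsimp only
              split_ifs
              · exact hstep c
              · linarith
        _ = 3 * ε + 6 * ε * (N + 6) * ∫ c : I, (if c < b then seedWeight c a else 0) := by
            rw [integral_add (integrable_const _) (hiw.const_mul _), integral_const,
              probReal_univ, one_smul, integral_const_mul]
        _ ≤ 3 * ε + 6 * ε * (N + 6) * ((W - 1) / 2) := by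
            gcongr
            exact integral_seedWeight_le a b
        _ ≤ _ := by
            have : 0 ≤ ε * (N + 6) := by positivity
            nlinarith
    have hLw : L = (K.erase w').erase w := by rw [hL, Finset.erase_right_comm]
    have hYw : ∀ ω, Y (K.erase w') w ω =
        (if ω.1 w < b then freeInd L w (ω.1 w) a ω else 0) - r := by
      intro ω
      simp only [hY, offerInd]
      rw [← hLw]
    have hYw' : ∀ ω, Y (K.erase w) w' ω =
        (if ω.1 w' < b then freeInd L w' (ω.1 w') a ω else 0) - r := fun ω => rfl
    -- After the deletions the offer of `w'` ignores the seed of `w` and all edges at `w`, so `w`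
    -- can be averaged out first and `w'` afterwards.
    have hA : ∫ ω, Y (K.erase w') w ω * Y (K.erase w) w' ω ∂law x =
        ∫ ω, offerDev x L w a b ω * Y (K.erase w) w' ω ∂law x := by
      simp_rw [hYw]
      refine integral_offer_sub_mul x hwL a b (hYm _ _) (hY1 _ _) (fun z hz => ?_) ?_
      · intro t act act' h
        have := edgeFree_offerInd (G := G) (fun _ => a) (fun _ => b) (Sym2.mem_mk_left w z)
          (show w' ∈ K.erase w by simp [hne.symm, hw']) (by simp) t act act' h
        simp only [hY]
        dsimp only at this
        rw [this]
      · intro t t' act h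
        simp only [hY]
        rw [seedFree_offerInd a b (show w' ∈ K.erase w by simp [hne.symm, hw']) (by simp)
          t t' act h]
    have hB : ∫ ω, Y (K.erase w) w' ω * offerDev x L w a b ω ∂law x =
        ∫ ω, offerDev x L w' a b ω * offerDev x L w a b ω ∂law x := by
      simp_rw [hYw']
      exact integral_offer_sub_mul x hw'L a b (measurable_offerDev x L w a b)
        (abs_offerDev_le_one x L w a b)
        (fun z _ => edgeFree_offerDev x a b (Sym2.mem_mk_left w' z) hw'L)
        (seedFree_offerDev x a b hw'L)
    have hdi : ∀ v, Integrable (fun ω => offerDev x L v a b ω ^ 2) (law x) := by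
      intro v
      refine integrable_of_abs_le ((measurable_offerDev x L v a b).pow_const 2) (C := 1) fun ω => ?_
      rw [abs_pow]
      exact pow_le_one₀ (abs_nonneg _) (abs_offerDev_le_one x L v a b ω)
    have hdd : Integrable (fun ω => offerDev x L w' a b ω * offerDev x L w a b ω) (law x) := by
      refine integrable_of_abs_le ((measurable_offerDev x L w' a b).mul
        (measurable_offerDev x L w a b)) (C := 1) fun ω => ?_
      rw [abs_mul]
      exact mul_le_one₀ (abs_offerDev_le_one _ _ _ _ _ _) (abs_nonneg _)
        (abs_offerDev_le_one _ _ _ _ _ _)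
    have hC : ∫ ω, offerDev x L w' a b ω * offerDev x L w a b ω ∂law x ≤
        3 * ε + 3 * ε * (N + 6) * W := by
      have h1 : ∫ ω, offerDev x L w' a b ω * offerDev x L w a b ω ∂law x ≤
          ∫ ω, (1 / 2 * offerDev x L w' a b ω ^ 2 + 1 / 2 * offerDev x L w a b ω ^ 2) ∂law x := by
        refine integral_mono hdd (((hdi w').const_mul _).add ((hdi w).const_mul _)) fun ω => ?_
        dsimp only
        nlinarith [sq_nonneg (offerDev x L w' a b ω - offerDev x L w a b ω)]
      rw [integral_add ((hdi w').const_mul _) ((hdi w).const_mul _), integral_const_mul,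
        integral_const_mul] at h1
      linarith [hdev w hwL, hdev w' hw'L]
    have hi1 : Integrable (fun ω => |Y K w ω - Y (K.erase w') w ω|) (law x) :=
      ((integrable_of_abs_le (hYm _ _) (hY1 _ _)).sub
        (integrable_of_abs_le (hYm _ _) (hY1 _ _))).abs
    have hi2 : Integrable (fun ω => |Y K w' ω - Y (K.erase w) w' ω|) (law x) :=
      ((integrable_of_abs_le (hYm _ _) (hY1 _ _)).sub
        (integrable_of_abs_le (hYm _ _) (hY1 _ _))).abs
    have hi3 : Integrable (fun ω => Y (K.erase w') w ω * Y (K.erase w) w' ω) (law x) := by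
      refine integrable_of_abs_le ((hYm _ _).mul (hYm _ _)) (C := 1) fun ω => ?_
      rw [abs_mul]
      exact mul_le_one₀ (hY1 _ _ _) (abs_nonneg _) (hY1 _ _ _)
    have hi12 : Integrable (fun ω => |Y K w ω - Y (K.erase w') w ω| +
        |Y K w' ω - Y (K.erase w) w' ω|) (law x) := hi1.add hi2
    have hpt : ∀ ω, Y K w ω * Y K w' ω ≤ Y (K.erase w') w ω * Y (K.erase w) w' ω +
        (|Y K w ω - Y (K.erase w') w ω| + |Y K w' ω - Y (K.erase w) w' ω|) := by
      intro ω
      have h1 : (Y K w ω - Y (K.erase w') w ω) * Y K w' ω ≤ |Y K w ω - Y (K.erase w') w ω| := by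
        refine (le_abs_self _).trans ?_
        rw [abs_mul]
        exact mul_le_of_le_one_right (abs_nonneg _) (hY1 _ _ _)
      have h2 : Y (K.erase w') w ω * (Y K w' ω - Y (K.erase w) w' ω) ≤
          |Y K w' ω - Y (K.erase w) w' ω| := by
        refine (le_abs_self _).trans ?_
        rw [abs_mul]
        exact mul_le_of_le_one_left (abs_nonneg _) (hY1 _ _ _)
      linarith
    have hfin := integral_mono (integrable_of_abs_le (hYYm w w') (hYY1 w w')) (hi3.add hi12) hpt
    have hadd : ∫ ω, ((fun ω => Y (K.erase w') w ω * Y (K.erase w) w' ω) +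
        fun ω => |Y K w ω - Y (K.erase w') w ω| + |Y K w' ω - Y (K.erase w) w' ω|) ω ∂law x =
        ∫ ω, Y (K.erase w') w ω * Y (K.erase w) w' ω ∂law x +
          (∫ ω, |Y K w ω - Y (K.erase w') w ω| ∂law x +
            ∫ ω, |Y K w' ω - Y (K.erase w) w' ω| ∂law x) := by
      rw [← integral_add hi1 hi2, ← integral_add hi3 hi12]
      rfl
    have hmain : ∫ ω, Y (K.erase w') w ω * Y (K.erase w) w' ω ∂law x ≤
        3 * ε + 3 * ε * (N + 6) * W := by
      rw [hA]
      simp_rw [mul_comm (offerDev x L w a b _)]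
      rw [hB]
      exact hC
    have hd1 := hdel w w' hw hw' hne
    have hd2 := hdel w' w hw' hw hne.symm
    -- `T` collects the two deletions, at most `ε * W / 2` each, the loss `3 * ε` between product
    -- and exponential, and the halved inductive error.
    refine (hfin.trans_eq hadd).trans ?_
    rw [hT]
    linarith
  -- the missing mass at `u`
  set m := 1 - ∑ w ∈ K, edgeWeight x s(u, w) with hm
  have hm0 : 0 ≤ m := by linarith [sum_edgeWeight_le x hx K u]
  have hm1 : m ≤ 1 := by
    have := Finset.sum_nonneg fun w (_ : w ∈ K) => edgeWeight_nonneg x s(u, w)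
    linarith
  -- Every vertex outside `K` removes at most `ε` of the weight at `u`; this is why the bound must
  -- depend on the size of the complement.
  have hmN : m ≤ N * ε := by
    have h1 : m = ∑ w ∈ Kᶜ, edgeWeight x s(u, w) := by
      rw [hm, ← hx u, ← Finset.sum_add_sum_compl K]
      ring
    rw [h1, hN, ← nsmul_eq_mul]
    exact Finset.sum_le_card_nsmul _ _ _ fun w _ => hε _
  set S : (V → I) × (G.edgeSet → Bool) → ℝ := fun ω => ∑ w ∈ K, edgeWeight x s(u, w) * Y K w ω
    with hS
  have hSeq : ∀ ω, offerMass x K u a b ω - r = S ω - r * m := by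
    intro ω
    simp only [hS, hY, offerMass, hm, mul_sub, Finset.sum_sub_distrib, ← Finset.sum_mul]
    ring
  have hS1 : ∀ ω, |S ω| ≤ 1 := by
    intro ω
    refine (Finset.abs_sum_le_sum_abs _ _).trans (le_trans (Finset.sum_le_sum fun w _ => ?_)
      (sum_edgeWeight_le x hx K u))
    rw [abs_mul, abs_of_nonneg (edgeWeight_nonneg _ _)]
    exact mul_le_of_le_one_right (edgeWeight_nonneg _ _) (hY1 _ _ _)
  have hSm : Measurable S := Finset.measurable_sum _ fun w _ => measurable_const.mul (hYm K w)
  have hSi : Integrable (fun ω => S ω ^ 2) (law x) := by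
    refine integrable_of_abs_le (hSm.pow_const 2) (C := 1) fun ω => ?_
    rw [abs_pow]
    exact pow_le_one₀ (abs_nonneg _) (hS1 ω)
  -- From `|S| ≤ 1`, `r ≤ 1` and `m ≤ 1`: `(S - r * m) ^ 2 ≤ S ^ 2 + 2 * m + m ^ 2 ≤ S ^ 2 + 3 * m`.
  have hpt : ∀ ω, (offerMass x K u a b ω - r) ^ 2 ≤ S ω ^ 2 + 3 * N * ε := by
    intro ω
    rw [hSeq]
    have h1 := abs_le.1 (hS1 ω)
    have h2 : 0 ≤ r * m := mul_nonneg hr01.1 hm0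
    have h3 : r * m ≤ m := mul_le_of_le_one_left hm0 hr01.2
    nlinarith
  have hS2 : ∫ ω, S ω ^ 2 ∂law x ≤ ε + T := by
    have h1 : ∀ ω, S ω ^ 2 = ∑ w ∈ K, ∑ w' ∈ K,
        edgeWeight x s(u, w) * edgeWeight x s(u, w') * (Y K w ω * Y K w' ω) := by
      intro ω
      rw [sq, hS, Finset.sum_mul_sum]
      refine Finset.sum_congr rfl fun w _ => Finset.sum_congr rfl fun w' _ => ?_
      ring
    have hi : ∀ w w', Integrable (fun ω =>
        edgeWeight x s(u, w) * edgeWeight x s(u, w') * (Y K w ω * Y K w' ω)) (law x) :=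
      fun w w' => (integrable_of_abs_le (hYYm w w') (hYY1 w w')).const_mul _
    simp_rw [h1]
    rw [integral_finsetSum _ fun w _ => integrable_finsetSum _ fun w' _ => hi w w']
    simp_rw [integral_finsetSum _ fun w' _ => hi _ w', integral_const_mul]
    have h2 : ∀ w ∈ K, ∑ w' ∈ K, edgeWeight x s(u, w) * edgeWeight x s(u, w') *
        ∫ ω, Y K w ω * Y K w' ω ∂law x ≤ edgeWeight x s(u, w) * (ε + T) := by
      intro w hw
      have h3 : ∀ w' ∈ K, edgeWeight x s(u, w) * edgeWeight x s(u, w') *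
          ∫ ω, Y K w ω * Y K w' ω ∂law x ≤ edgeWeight x s(u, w) *
            ((if w = w' then ε else 0) + edgeWeight x s(u, w') * T) := by
        intro w' hw'
        rw [mul_assoc]
        refine mul_le_mul_of_nonneg_left ?_ (edgeWeight_nonneg _ _)
        by_cases h : w = w'
        · have h4 : ∫ ω, Y K w ω * Y K w' ω ∂law x ≤ 1 := by
            have := integral_mono (μ := law x) (integrable_of_abs_le (hYYm w w') (hYY1 w w'))
              (integrable_const (1 : ℝ)) fun ω => (le_abs_self _).trans (hYY1 w w' ω)
            simpa using this
          have h5 := mul_le_mul_of_nonneg_left h4 (edgeWeight_nonneg x s(u, w'))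
          have h6 := mul_nonneg (edgeWeight_nonneg x s(u, w')) hT0
          rw [if_pos h]
          linarith [hε s(u, w')]
        · rw [if_neg h, zero_add]
          exact mul_le_mul_of_nonneg_left (hoff w hw w' hw' h) (edgeWeight_nonneg _ _)
      refine (Finset.sum_le_sum h3).trans ?_
      rw [← Finset.mul_sum]
      refine mul_le_mul_of_nonneg_left ?_ (edgeWeight_nonneg _ _)
      rw [Finset.sum_add_distrib, Finset.sum_ite_eq, if_pos hw, ← Finset.sum_mul]
      have := mul_le_mul_of_nonneg_right (sum_edgeWeight_le x hx K u) hT0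
      linarith
    refine (Finset.sum_le_sum h2).trans ?_
    rw [← Finset.sum_mul]
    exact mul_le_of_le_one_left (by linarith) (sum_edgeWeight_le x hx K u)
  calc ∫ ω, (offerMass x K u a b ω - r) ^ 2 ∂law x
      ≤ ∫ ω, (S ω ^ 2 + 3 * N * ε) ∂law x :=
        integral_mono_of_nonneg (Eventually.of_forall fun ω => sq_nonneg _)
          (hSi.add (integrable_const _)) (Eventually.of_forall hpt)
    _ = ∫ ω, S ω ^ 2 ∂law x + 3 * N * ε := by
        rw [integral_add hSi (integrable_const _)]
        simp
    _ ≤ ε + T + 3 * N * ε := by linarith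
    -- As `W ≥ 1`, the total is at most `ε * W` times `1 + 1 + 3 + 3 * (N + 6) + 3 * N = 6 * N +
    -- 23`, just below `6 * (N + 4)`.
    _ ≤ 6 * ε * (N + 4) * W := by
        have h1 : 0 ≤ ε * (W - 1) := mul_nonneg hε0 (by linarith)
        have h2 : 0 ≤ N * (ε * (W - 1)) := mul_nonneg hN0 h1
        rw [hT]
        nlinarith

end Concentration

/-! ### The selection probability of an edge -/

section Selection

variable {V : Type*} [Fintype V] [DecidableEq V] {G : SimpleGraph V} [DecidableRel G.Adj]

lemma ae_injective_seed (x : G.edgeSet → I) : ∀ᵐ ω ∂law x, Function.Injective ω.1 := by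
  have hpair : ∀ v w : V, v ≠ w → ∀ᵐ ω ∂law x, ω.1 v ≠ ω.1 w := by
    intro v w hvw
    set Y : I → (V → I) × (G.edgeSet → Bool) → ℝ := fun c ω => if c = ω.1 w then 1 else 0 with hY
    have hYm : Measurable (Function.uncurry Y) :=
      Measurable.ite (measurableSet_eq_fun measurable_fst ((measurable_seed w).comp measurable_snd))
        measurable_const measurable_const
    have hY1 : ∀ c ω, |Y c ω| ≤ 1 := by
      intro c ω
      simp only [hY]
      split_ifs <;> simp
    have hYf : ∀ c, SeedFree (Y c) v := by
      intro c t t' act h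
      simp only [hY, h w hvw.symm]
    have h0 : ∫ ω, Y (ω.1 v) ω ∂law x = 0 := by
      rw [integral_seed x v hYm hY1 hYf]
      refine integral_eq_zero_of_ae (Eventually.of_forall fun ω => integral_eq_zero_of_ae ?_)
      have : ∀ᵐ c : I, c ≠ ω.1 w := by
        rw [ae_iff]
        simp
      filter_upwards [this] with c hc
      simp [hY, hc]
    have hm : Measurable fun ω : (V → I) × (G.edgeSet → Bool) => Y (ω.1 v) ω :=
      hYm.comp ((measurable_seed v).prodMk measurable_id)
    rw [integral_eq_zero_iff_of_nonneg (fun ω => by simp only [hY]; split_ifs <;> simp)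
      (integrable_of_abs_le hm fun ω => hY1 _ ω)] at h0
    filter_upwards [h0] with ω hω heq
    simp [hY, heq] at hω
  have hall : ∀ᵐ ω ∂law x, ∀ v w : V, v ≠ w → ω.1 v ≠ ω.1 w := by
    simp_rw [ae_all_iff]
    exact hpair
  filter_upwards [hall] with ω hω v w h
  by_contra hvw
  exact hω v w hvw h

/-- With `s = √ε`, the inequality `|y| ≤ s + y ^ 2 / s` converts a mean square error of order `ε`
into a mean error of order `√ε`. The constant `36` is `6 * (2 + 4)`, as only the two endpoints are
missing from `L`. -/
lemma integral_abs_meanFree_sub_le (x : G.edgeSet → I)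
    (hx : ∀ u, ∑ w, edgeWeight x s(u, w) = 1) {ε : ℝ} (hε : ∀ e, edgeWeight x e ≤ ε)
    (hε0 : 0 < ε) (hε1 : ε ≤ 1) {L : Finset V} {u : V} (hu : u ∉ L) (hL : Lᶜ.card = 2) (a b : I) :
    ∫ ω, |meanFree x L u a b ω - freeProb a b| ∂law x ≤ (4 + 36 * Real.exp 4) * √ε := by
  have hs := Real.sqrt_pos.2 hε0
  have hss := Real.mul_self_sqrt hε0.le
  set s := √ε
  have h1 := integral_meanFree_sub_sq_le x hx hε hε1 L u a b
  have h2 := integral_offerMass_sub_sq_le x hx hε hε1 L hu a b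
  rw [hL] at h2
  have h3 : ∫ ω, (meanFree x L u a b ω - freeProb a b) ^ 2 ∂law x ≤
      s * s * (3 + 36 * Real.exp 4) := by
    rw [hss]
    have := mul_le_mul_of_nonneg_left (seedWeight_le a b) hε0.le
    push_cast at h2
    linarith
  have hm : Measurable fun ω => meanFree x L u a b ω - freeProb a b :=
    (measurable_meanFree x L u measurable_const measurable_const measurable_id).sub
      measurable_const
  have hi : Integrable (fun ω => (meanFree x L u a b ω - freeProb a b) ^ 2) (law x) := by
    refine integrable_of_abs_le (hm.pow_const 2) (C := 1) fun ω => ?_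
    have h4 := meanFree_mem_Icc x L u a b ω
    have h5 := freeProb_mem_Icc a b
    rw [abs_pow]
    refine pow_le_one₀ (abs_nonneg _) (abs_le.2 ?_)
    constructor <;> linarith [h4.1, h4.2, h5.1, h5.2]
  have hpt : ∀ ω, |meanFree x L u a b ω - freeProb a b| ≤
      s + s⁻¹ * (meanFree x L u a b ω - freeProb a b) ^ 2 := by
    intro ω
    set y := meanFree x L u a b ω - freeProb a b
    rw [← sq_abs]
    have h6 : 0 ≤ s⁻¹ * (|y| - s) ^ 2 := by positivity
    have h7 : s⁻¹ * (|y| - s) ^ 2 = s⁻¹ * |y| ^ 2 - 2 * |y| + s := by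
      field_simp
      ring
    linarith [abs_nonneg y]
  calc _ ≤ ∫ ω, (s + s⁻¹ * (meanFree x L u a b ω - freeProb a b) ^ 2) ∂law x :=
        integral_mono_of_nonneg (Eventually.of_forall fun ω => abs_nonneg _)
          ((integrable_const _).add (hi.const_mul _)) (Eventually.of_forall hpt)
    _ = s + s⁻¹ * ∫ ω, (meanFree x L u a b ω - freeProb a b) ^ 2 ∂law x := by
        rw [integral_add (integrable_const _) (hi.const_mul _), integral_const, probReal_univ,
          one_smul, integral_const_mul]
    _ ≤ s + s⁻¹ * (s * s * (3 + 36 * Real.exp 4)) := by gcongr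
    _ = _ := by
        field_simp
        ring

lemma le_integral_meanFree_mul_meanFree (x : G.edgeSet → I)
    (hx : ∀ u, ∑ w, edgeWeight x s(u, w) = 1) {ε : ℝ} (hε : ∀ e, edgeWeight x e ≤ ε)
    (hε0 : 0 < ε) (hε1 : ε ≤ 1) {L : Finset V} {u v : V} (hu : u ∉ L) (hv : v ∉ L)
    (hL : Lᶜ.card = 2) (a b : I) :
    freeProb a b * freeProb b a - (8 + 72 * Real.exp 4) * √ε ≤
      ∫ ω, meanFree x L u a b ω * meanFree x L v b a ω ∂law x := by
  have habs : ∀ {p : ℝ}, p ∈ Set.Icc (0 : ℝ) 1 → |p| ≤ 1 := by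
    intro p hp
    rw [abs_of_nonneg hp.1]
    exact hp.2
  have hm : ∀ w c d, Measurable fun ω => meanFree x L w c d ω := fun w c d =>
    measurable_meanFree x L w measurable_const measurable_const measurable_id
  have hdi : ∀ w c d, Integrable (fun ω => |meanFree x L w c d ω - freeProb c d|) (law x) :=
    fun w c d => ((integrable_of_abs_le (hm w c d) fun ω =>
      habs (meanFree_mem_Icc _ _ _ _ _ _)).sub (integrable_const _)).abs
  have hZi : Integrable (fun ω => meanFree x L u a b ω * meanFree x L v b a ω) (law x) := by
    refine integrable_of_abs_le ((hm u a b).mul (hm v b a)) (C := 1) fun ω => ?_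
    rw [abs_mul]
    exact mul_le_one₀ (habs (meanFree_mem_Icc _ _ _ _ _ _)) (abs_nonneg _)
      (habs (meanFree_mem_Icc _ _ _ _ _ _))
  have hpt : ∀ ω, freeProb a b * freeProb b a ≤
      meanFree x L u a b ω * meanFree x L v b a ω +
      (|meanFree x L u a b ω - freeProb a b| + |meanFree x L v b a ω - freeProb b a|) := by
    intro ω
    have e1 : (freeProb a b - meanFree x L u a b ω) * freeProb b a ≤
        |meanFree x L u a b ω - freeProb a b| := by
      refine (le_abs_self _).trans ?_
      rw [abs_mul, abs_sub_comm]
      exact mul_le_of_le_one_right (abs_nonneg _) (habs (freeProb_mem_Icc b a))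
    have e2 : meanFree x L u a b ω * (freeProb b a - meanFree x L v b a ω) ≤
        |meanFree x L v b a ω - freeProb b a| := by
      refine (le_abs_self _).trans ?_
      rw [abs_mul, abs_sub_comm]
      exact mul_le_of_le_one_left (abs_nonneg _) (habs (meanFree_mem_Icc x L u a b ω))
    linarith
  have hdd : Integrable (fun ω => |meanFree x L u a b ω - freeProb a b| +
      |meanFree x L v b a ω - freeProb b a|) (law x) := (hdi u a b).add (hdi v b a)
  have h : ∫ _, freeProb a b * freeProb b a ∂law x ≤
      ∫ ω, (meanFree x L u a b ω * meanFree x L v b a ω +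
        (|meanFree x L u a b ω - freeProb a b| + |meanFree x L v b a ω - freeProb b a|)) ∂law x :=
    integral_mono (integrable_const _) (hZi.add hdd) hpt
  rw [integral_const, probReal_univ, one_smul, integral_add hZi hdd,
    integral_add (hdi u a b) (hdi v b a)] at h
  have := integral_abs_meanFree_sub_le x hx hε hε0 hε1 hu hL a b
  have := integral_abs_meanFree_sub_le x hx hε hε0 hε1 hv hL b a
  linarith

lemma integral_meanFree_mul_meanFree (x : G.edgeSet → I) {L : Finset V} {u v : V} (huv : u ≠ v)
    (hu : u ∉ L) (hv : v ∉ L) :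
    ∫ ω, meanFree x L u (ω.1 u) (ω.1 v) ω * meanFree x L v (ω.1 v) (ω.1 u) ω ∂law x =
      ∫ a, ∫ b, (∫ ω, meanFree x L u a b ω * meanFree x L v b a ω ∂law x) := by
  have hmul : ∀ {p q : ℝ}, p ∈ Set.Icc (0 : ℝ) 1 → q ∈ Set.Icc (0 : ℝ) 1 → |p * q| ≤ 1 := by
    intro p q hp hq
    rw [abs_of_nonneg (mul_nonneg hp.1 hq.1)]
    exact mul_le_one₀ hp.2 hq.1 hq.2
  have hsv : Measurable fun p : I × ((V → I) × (G.edgeSet → Bool)) => p.2.1 v :=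
    (measurable_seed v).comp measurable_snd
  refine (integral_seed_swap x u (C := 1)
    (Y := fun a ω => meanFree x L u a (ω.1 v) ω * meanFree x L v (ω.1 v) a ω) ?_ ?_ ?_).trans ?_
  · exact (measurable_meanFree x L u measurable_fst hsv measurable_snd).mul
      (measurable_meanFree x L v hsv measurable_fst measurable_snd)
  · exact fun a ω => hmul (meanFree_mem_Icc _ _ _ _ _ _) (meanFree_mem_Icc _ _ _ _ _ _)
  · intro a t t' act h
    dsimp only
    rw [h v huv.symm, seedFree_meanFree x _ _ hu t t' act h, seedFree_meanFree x _ _ hu t t' act h]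
  · congr 1
    ext a
    refine integral_seed_swap x v (C := 1)
      (Y := fun b ω => meanFree x L u a b ω * meanFree x L v b a ω) ?_ ?_ ?_
    · exact (measurable_meanFree x L u measurable_const measurable_fst measurable_snd).mul
        (measurable_meanFree x L v measurable_fst measurable_const measurable_snd)
    · exact fun b ω => hmul (meanFree_mem_Icc _ _ _ _ _ _) (meanFree_mem_Icc _ _ _ _ _ _)
    · intro b t t' act h
      dsimp only
      rw [seedFree_meanFree x _ _ hv t t' act h, seedFree_meanFree x _ _ hv t t' act h]

/-- Neither factor sees the edges from the other root to `L`, so the edges at `u` and then those at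
`v` are averaged, with the other factor as test factor. -/
lemma integral_freeInd_mul_freeInd (x : G.edgeSet → I) {L : Finset V} {u v : V} (huv : u ≠ v)
    (hu : u ∉ L) (hv : v ∉ L) :
    ∫ ω, freeInd L u (ω.1 u) (ω.1 v) ω * freeInd L v (ω.1 v) (ω.1 u) ω ∂law x =
      ∫ ω, meanFree x L u (ω.1 u) (ω.1 v) ω * meanFree x L v (ω.1 v) (ω.1 u) ω ∂law x := by
  have habs : ∀ {p : ℝ}, p ∈ Set.Icc (0 : ℝ) 1 → |p| ≤ 1 := by
    intro p hp
    rw [abs_of_nonneg hp.1]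
    exact hp.2
  have hAu : Measurable fun t : V → I => t u := measurable_pi_apply u
  have hAv : Measurable fun t : V → I => t v := measurable_pi_apply v
  have hF : Measurable fun ω : (V → I) × (G.edgeSet → Bool) => freeInd L v (ω.1 v) (ω.1 u) ω :=
    measurable_freeInd L v (measurable_seed v) (measurable_seed u) measurable_id
  have hP : Measurable fun ω : (V → I) × (G.edgeSet → Bool) =>
      meanFree x L u (ω.1 u) (ω.1 v) ω :=
    measurable_meanFree x L u (measurable_seed u) (measurable_seed v) measurable_id
  refine (integral_freeInd_mul x hu hAu hAv hF (fun ω => habs (freeInd_mem_Icc _ _ _ _ _))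
    (fun z _ => edgeFree_freeInd (fun t => t v) (fun t => t u) (Sym2.mem_mk_left u z)
      (by simp [huv, hu]))).trans ?_
  simp_rw [mul_comm (meanFree x L u _ _ _)]
  exact integral_freeInd_mul x hv hAv hAu hP (fun ω => habs (meanFree_mem_Icc _ _ _ _ _ _))
    (fun z _ => edgeFree_meanFree x (fun t => t u) (fun t => t v) (Sym2.mem_mk_left v z) hv)

lemma le_integral_freeInd_mul_freeInd (x : G.edgeSet → I)
    (hx : ∀ u, ∑ w, edgeWeight x s(u, w) = 1) {ε : ℝ} (hε : ∀ e, edgeWeight x e ≤ ε)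
    (hε0 : 0 < ε) (hε1 : ε ≤ 1) {L : Finset V} {u v : V} (huv : u ≠ v) (hu : u ∉ L) (hv : v ∉ L)
    (hL : Lᶜ.card = 2) :
    1 - Real.log (2 - 1 / Real.exp 1) - (8 + 72 * Real.exp 4) * √ε ≤
      ∫ ω, freeInd L u (ω.1 u) (ω.1 v) ω * freeInd L v (ω.1 v) (ω.1 u) ω ∂law x := by
  set κ := (8 + 72 * Real.exp 4) * √ε
  rw [integral_freeInd_mul_freeInd x huv hu hv, integral_meanFree_mul_meanFree x huv hu hv,
    ← integral_integral_freeProb_mul]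
  have hmul : ∀ {p q : ℝ}, p ∈ Set.Icc (0 : ℝ) 1 → q ∈ Set.Icc (0 : ℝ) 1 → |p * q| ≤ 1 := by
    intro p q hp hq
    rw [abs_of_nonneg (mul_nonneg hp.1 hq.1)]
    exact mul_le_one₀ hp.2 hq.1 hq.2
  have hφm : Measurable fun p : I × I => freeProb p.1 p.2 * freeProb p.2 p.1 :=
    measurable_freeProb.mul (measurable_freeProb.comp measurable_swap)
  have hφi : Integrable fun p : I × I => freeProb p.1 p.2 * freeProb p.2 p.1 :=
    integrable_of_abs_le hφm fun p => hmul (freeProb_mem_Icc _ _) (freeProb_mem_Icc _ _)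
  have hPm : Measurable fun q : (I × I) × ((V → I) × (G.edgeSet → Bool)) =>
      meanFree x L u q.1.1 q.1.2 q.2 * meanFree x L v q.1.2 q.1.1 q.2 :=
    (measurable_meanFree x L u measurable_fst.fst measurable_fst.snd measurable_snd).mul
      (measurable_meanFree x L v measurable_fst.snd measurable_fst.fst measurable_snd)
  have hPi : Integrable (fun q : (I × I) × ((V → I) × (G.edgeSet → Bool)) =>
      meanFree x L u q.1.1 q.1.2 q.2 * meanFree x L v q.1.2 q.1.1 q.2)
      ((volume : Measure (I × I)).prod (law x)) :=
    integrable_of_abs_le hPm fun q => hmul (meanFree_mem_Icc _ _ _ _ _ _)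
      (meanFree_mem_Icc _ _ _ _ _ _)
  have h : ∫ p : I × I, (freeProb p.1 p.2 * freeProb p.2 p.1 - κ) ≤
      ∫ p : I × I, (∫ ω, meanFree x L u p.1 p.2 ω * meanFree x L v p.2 p.1 ω ∂law x) :=
    integral_mono (hφi.sub (integrable_const _)) hPi.integral_prod_left fun p =>
      le_integral_meanFree_mul_meanFree x hx hε hε0 hε1 hu hv hL p.1 p.2
  rw [integral_sub hφi (integrable_const _), integral_const, probReal_univ, one_smul] at h
  have e1 : ∫ p : I × I, freeProb p.1 p.2 * freeProb p.2 p.1 =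
      ∫ a : I, ∫ b : I, freeProb a b * freeProb b a := integral_prod _ hφi
  have e2 : ∫ p : I × I, (∫ ω, meanFree x L u p.1 p.2 ω * meanFree x L v p.2 p.1 ω ∂law x) =
      ∫ a, ∫ b, (∫ ω, meanFree x L u a b ω * meanFree x L v b a ω ∂law x) :=
    integral_prod _ hPi.integral_prod_left
  rwa [e1, e2] at h

/-- The state of `e` is independent of both free indicators, and an active edge with two free
endpoints is selected outside the null event of equal seeds. -/
lemma mul_integral_freeInd_le (x : G.edgeSet → I) {e : G.edgeSet} {u v : V}
    (he : (e : Sym2 V) = s(u, v)) :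
    (x e : ℝ) * ∫ ω, freeInd ((Finset.univ.erase u).erase v) u (ω.1 u) (ω.1 v) ω *
      freeInd ((Finset.univ.erase u).erase v) v (ω.1 v) (ω.1 u) ω ∂law x ≤
      (law x).real {ω | e ∈ greedyMatching ω.2 (lexOrder G ω.1)} := by
  have huv : u ≠ v := by
    have h2 := e.2
    rw [he] at h2
    exact (G.mem_edgeSet.1 h2).ne
  set L := (Finset.univ.erase u).erase v with hL
  have huL : u ∉ L := by simp [hL]
  have hvL : v ∉ L := by simp [hL]
  set X : (V → I) × (G.edgeSet → Bool) → ℝ := fun ω =>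
    freeInd L u (ω.1 u) (ω.1 v) ω * freeInd L v (ω.1 v) (ω.1 u) ω with hX
  have hX01 : ∀ ω, 0 ≤ X ω ∧ X ω ≤ 1 := by
    intro ω
    have h1 := freeInd_mem_Icc L u (ω.1 u) (ω.1 v) ω
    have h2 := freeInd_mem_Icc L v (ω.1 v) (ω.1 u) ω
    exact ⟨mul_nonneg h1.1 h2.1, mul_le_one₀ h1.2 h2.1 h2.2⟩
  have hXm : Measurable X :=
    (measurable_freeInd L u (measurable_seed u) (measurable_seed v) measurable_id).mul
      (measurable_freeInd L v (measurable_seed v) (measurable_seed u) measurable_id)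
  have hX1 : ∀ ω, |X ω| ≤ 1 := fun ω => by
    rw [abs_of_nonneg (hX01 ω).1]
    exact (hX01 ω).2
  have hXf : EdgeFree X s(u, v) := by
    intro t act act' h
    have h1 := edgeFree_freeInd (G := G) (K := L) (u := u) (fun t => t u) (fun t => t v)
      (Sym2.mem_mk_right u v) (by simp [huv.symm, hvL]) t act act' h
    have h2 := edgeFree_freeInd (G := G) (K := L) (u := v) (fun t => t v) (fun t => t u)
      (Sym2.mem_mk_left u v) (by simp [huv, huL]) t act act' h
    simp only [hX]
    dsimp only at h1 h2
    rw [h1, h2]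
  have h1 := integral_activeInd_mul x s(u, v) hXm hX1 hXf
  rw [← he, edgeWeight_coe] at h1
  rw [← h1]
  set W : (V → I) × (G.edgeSet → Bool) → ℝ := fun ω => activeInd ω.2 e * X ω with hW
  have hWm : Measurable W := ((measurable_activeInd _).comp measurable_snd).mul hXm
  have hT : MeasurableSet {ω | W ω ≠ 0} := (measurableSet_eq_fun hWm measurable_const).compl
  calc ∫ ω, W ω ∂law x ≤ ∫ ω, {ω | W ω ≠ 0}.indicator (fun _ => (1 : ℝ)) ω ∂law x := by
        refine integral_mono_of_nonneg (Eventually.of_forall fun ω =>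
          mul_nonneg (activeInd_nonneg _ _) (hX01 ω).1) ((integrable_const _).indicator hT)
          (Eventually.of_forall fun ω => ?_)
        by_cases h : W ω = 0
        · simp [h]
        · rw [Set.indicator_of_mem (show ω ∈ {ω | W ω ≠ 0} from h)]
          exact mul_le_one₀ (activeInd_le_one _ _) (hX01 ω).1 (hX01 ω).2
    _ = (law x).real {ω | W ω ≠ 0} := integral_indicator_one hT
    -- Monotonicity up to null sets needs no measurability of the selection event.
    _ ≤ _ := by
        refine ENNReal.toReal_mono (measure_ne_top _ _) (measure_mono_ae ?_)
        filter_upwards [ae_injective_seed x] with ω hω h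
        exact mem_greedyMatching_of_freeInd hω he (by rw [← he]; exact h)

lemma sum_edgeWeight_eq_one {x : G.edgeSet → I} (hx : IsOneRegular G x) (u : V) :
    ∑ w, edgeWeight x s(u, w) = 1 := by
  rw [← hx u, ← Finset.sum_filter_of_ne (p := fun w => G.Adj u w)]
  · refine Finset.sum_bij (fun w hw => ⟨s(u, w), (Finset.mem_filter.1 hw).2⟩) ?_ ?_ ?_ ?_
    · intro w hw
      simp
    · intro w hw w' hw' h
      exact Sym2.congr_right.1 (Subtype.ext_iff.1 h)
    · rintro ⟨e, he⟩ hue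
      simp only [Finset.mem_filter, Finset.mem_univ, true_and] at hue
      obtain ⟨w, rfl⟩ := hue
      exact ⟨w, by simpa using he, rfl⟩
    · intro w hw
      exact edgeWeight_coe x ⟨s(u, w), _⟩
  · intro w _ h
    by_contra hne
    exact h (by simp [edgeWeight, hne])

/-- A quantitative form of selectability, with an error of order `√ε`. -/
theorem lexGreedySelectable_of_le {x : G.edgeSet → I} (hx : IsOneRegular G x) {ε : ℝ}
    (hε : ∀ e, (x e : ℝ) ≤ ε) :
    LexGreedySelectable (1 - Real.log (2 - 1 / Real.exp 1) - (8 + 72 * Real.exp 4) * √ε) x := by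
  intro e
  obtain ⟨u, v, he⟩ : ∃ u v, (e : Sym2 V) = s(u, v) := by
    obtain ⟨e, h⟩ := e
    induction e with | _ u v => exact ⟨u, v, rfl⟩
  have hxe := (x e).2.1
  rcases hxe.eq_or_lt with h0 | hpos
  · rw [← h0, mul_zero]
    exact measureReal_nonneg
  have hε0 : 0 < ε := hpos.trans_le (hε e)
  rcases le_total ε 1 with hε1 | hε1
  · have hw : ∀ e, edgeWeight x e ≤ ε := by
      intro e
      unfold edgeWeight
      split_ifs
      · exact hε _
      · exact hε0.le
    have huv : u ≠ v := by
      have h2 := e.2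
      rw [he] at h2
      exact (G.mem_edgeSet.1 h2).ne
    refine le_trans ?_ (mul_integral_freeInd_le x he)
    rw [mul_comm]
    refine mul_le_mul_of_nonneg_left ?_ hxe
    refine le_integral_freeInd_mul_freeInd x (sum_edgeWeight_eq_one hx) hw hε0 hε1 huv
      (by simp) (by simp) ?_
    have : ((Finset.univ.erase u).erase v)ᶜ = {u, v} := by
      ext w
      simp only [Finset.mem_compl, Finset.mem_erase, Finset.mem_univ, Finset.mem_insert,
        Finset.mem_singleton]
      tauto
    rw [this, Finset.card_pair huv]
  -- For `ε ≥ 1` the error term alone exceeds `1`, so the claimed constant is nonpositive.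
  · refine le_trans (mul_nonpos_of_nonpos_of_nonneg ?_ hxe) measureReal_nonneg
    have h1 : 1 ≤ √ε := Real.one_le_sqrt.2 hε1
    have h2 : 0 ≤ Real.log (2 - 1 / Real.exp 1) := by
      refine Real.log_nonneg ?_
      have : 1 / Real.exp 1 ≤ 1 := by
        rw [div_le_one (Real.exp_pos 1)]
        exact Real.one_le_exp zero_le_one
      linarith
    have h3 := Real.exp_pos 4
    nlinarith

lemma tendsto_mul_sqrt_zero {ι : Type*} {l : Filter ι} {ε : ι → ℝ} (h : Tendsto ε l (𝓝 0))
    (C : ℝ) : Tendsto (fun i => C * √(ε i)) l (𝓝 0) := by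
  simpa using ((Real.continuous_sqrt.tendsto 0).comp h).const_mul C

end Selection

end GreedyCRS

end

theorem theorem4 :
    (∃ f : ℝ → ℝ, Tendsto f (𝓝[>] 0) (𝓝 0) ∧
      ∀ (V : Type*) [Fintype V] [DecidableEq V] (G : SimpleGraph V) [DecidableRel G.Adj]
        (x : G.edgeSet → I), GreedyCRS.IsOneRegular G x →
        GreedyCRS.LexGreedySelectable
          (1 - Real.log (2 - 1 / Real.exp 1) - f (⨆ e : G.edgeSet, (x e : ℝ))) x) ∧
    (∀ (V : ℕ → Type*) [∀ n, Fintype (V n)] [∀ n, DecidableEq (V n)]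
      (G : ∀ n, SimpleGraph (V n)) [∀ n, DecidableRel (G n).Adj]
      (x : ∀ n, (G n).edgeSet → I) (ε : ℕ → ℝ),
      (∀ n, GreedyCRS.IsOneRegular (G n) (x n)) →
      (∀ n, ∀ e : (G n).edgeSet, (x n e : ℝ) ≤ ε n) →
      Tendsto ε atTop (𝓝 0) →
      ∃ c : ℕ → ℝ, Tendsto c atTop (𝓝 (1 - Real.log (2 - 1 / Real.exp 1))) ∧
        ∀ n, GreedyCRS.LexGreedySelectable (c n) (x n)) := by
  refine ⟨⟨fun ε => (8 + 72 * Real.exp 4) * √ε,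
    GreedyCRS.tendsto_mul_sqrt_zero (tendsto_nhdsWithin_of_tendsto_nhds tendsto_id) _, ?_⟩, ?_⟩
  · intro V _ _ G _ x hx
    exact GreedyCRS.lexGreedySelectable_of_le hx fun e =>
      le_ciSup (f := fun e : G.edgeSet => (x e : ℝ)) (Set.finite_range _).bddAbove e
  · intro V _ _ G _ x ε hx hxε hε
    refine ⟨_, ?_, fun n => GreedyCRS.lexGreedySelectable_of_le (hx n) (hxε n)⟩
    simpa using (GreedyCRS.tendsto_mul_sqrt_zero hε (8 + 72 * Real.exp 4)).const_sub
      (1 - Real.log (2 - 1 / Real.exp 1))
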